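/- Theorem 1.1. Let $\mu>0$, $\sigma>0$ and $c\in(0,\infty)$. For each $n$ let $X=X_n$ be a $p\times n$ random matrix, $p=p(n)$, whose entries are independent real normal random variables with mean $\mu$ and variance $\sigma^2$, where $p/n\to c$ as $n\to\infty$. Let $W=XX^{T}/n$, let $\lambda_1(W)$ be its largest eigenvalue, and let $\lambda_1^{(1)}=\frac1p\sum_{i,j=1}^{p}W_{ij}$ be the average of its row sums. Then: (a) $\lambda_1(W)$ is asymptotically normal with expectation $p\mu^2+(1+c)\sigma^2$ and variance $4c\mu^2\sigma^2$; that is, as $n\to\infty$, $$\lambda_1(W)-\bigl(p\mu^2+(1+c)\sigma^2\bigr)\ \longrightarrow\ N\bigl(0,\,4c\mu^2\sigma^2\bigr)\quad\text{in distribution.}$$ (b) $\lambda_1(W)$ is approximated by $\lambda_1^{(1)}+p\sigma^2/n$ up to an error of order $\sqrt p/n$: there are positive constants $C_1,C_2,C_3$, depending only on $\mu,\sigma,c$, such that for all sufficiently large $n$ and all $x>0$, $$\mathbb P\left(\left|\lambda_1^{(1)}+\frac{p\sigma^2}{n}-\lambda_1(W)\right|>\frac{C_1\sqrt p\,x}{n}\right)<\frac{C_2}{x^2}+\frac{C_3}{p}.$$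 -/

import Mathlib

open MeasureTheory ProbabilityTheory Filter Topology

/-- The sample covariance matrix `W = X Xᵀ / n` of a real `p × n` matrix `X`. -/
noncomputable def sampleCov {p n : ℕ} (X : Matrix (Fin p) (Fin n) ℝ) : Matrix (Fin p) (Fin p) ℝ :=
  (n : ℝ)⁻¹ • (X * X.transpose)

/-- The largest real root of the characteristic polynomial of `A`. For a symmetric matrix of
positive size the set of these roots is finite and nonempty and consists of all eigenvalues, so
this is the largest eigenvalue. -/
noncomputable def largestEigenvalue {p : ℕ} (A : Matrix (Fin p) (Fin p) ℝ) : ℝ :=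
  sSup {r : ℝ | A.charpoly.IsRoot r}

/-- The average row sum `(∑ i, ∑ j, A i j) / p` of a `p × p` matrix. -/
noncomputable def avgRowSum {p : ℕ} (A : Matrix (Fin p) (Fin p) ℝ) : ℝ :=
  (∑ i, ∑ j, A i j) / p

/-! Write X = μ + σg with g standard Gaussian and let u be the all-ones vector. Then Wu = θu + b,
where θ is the average row sum and b ⟂ u. If B is the compression of W to the complement of u,
eliminating that complement from the eigenvalue equation gives λ₁ - θ = bᵀ(λ₁ - B)⁻¹b / p. Since 0 ≤
B ≤ m with m = o(p), since λ₁ ≈ pμ², and since |b|²/p ≈ σ²μ²p²/n, the shift λ₁ - θ is close to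
pσ²/n. `largestEigenvalue_perturbation` provides the two inequalities that replace the exact
equation, and `abs_shift_sub_le` solves them.

All the randomness sits in five linear or quadratic statistics of g, collected in `IsTypical`. Their
second moments are controlled by one variance bound for Gaussian quadratic forms,
`integral_centredForm_sq_le`, so Chebyshev makes the typical event at level x fail with probability
O(x⁻²). The deterministic estimate needs x ≤ ε√p; beyond that range the level is frozen at ε√p,
which is the source of the C₃/p term in (b).

For (a), θ = pμ² + σ² + 2μσS/n + o(1) in probability, with S the sum of all entries of g. The term
2μσS/n is exactly Gaussian with variance 4μ²σ²p/n, so no central limit theorem is needed: the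
remainder tends to zero in probability and characteristic functions converge. -/

/-! ### Variational description of the largest eigenvalue -/

open Matrix in
lemma real_dotProduct_self_nonneg {ι : Type*} [Fintype ι] (v : ι → ℝ) : 0 ≤ v ⬝ᵥ v :=
  Finset.sum_nonneg fun i _ => mul_self_nonneg (v i)

open Matrix in
/-- The real roots of the characteristic polynomial are the real eigenvalues. -/
lemma isRoot_charpoly_iff_exists_eigenvector {p : ℕ} (A : Matrix (Fin p) (Fin p) ℝ) (r : ℝ) :
    A.charpoly.IsRoot r ↔ ∃ v : Fin p → ℝ, v ≠ 0 ∧ A *ᵥ v = r • v := by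
  rw [Polynomial.IsRoot, Matrix.eval_charpoly, ← Matrix.exists_mulVec_eq_zero_iff]
  simp only [Matrix.sub_mulVec, Matrix.scalar_apply, sub_eq_zero, ← Matrix.smul_one_eq_diagonal,
    Matrix.smul_mulVec, Matrix.one_mulVec, eq_comm, ne_eq]

lemma finite_setOf_isRoot_charpoly {p : ℕ} (A : Matrix (Fin p) (Fin p) ℝ) :
    {r : ℝ | A.charpoly.IsRoot r}.Finite :=
  Polynomial.finite_setOfPred_isRoot A.charpoly_monic.ne_zero

open Matrix in
lemma le_largestEigenvalue {p : ℕ} {A : Matrix (Fin p) (Fin p) ℝ} {r : ℝ} {v : Fin p → ℝ}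
    (hv : v ≠ 0) (h : A *ᵥ v = r • v) : r ≤ largestEigenvalue A :=
  le_csSup (finite_setOf_isRoot_charpoly A).bddAbove
    ((isRoot_charpoly_iff_exists_eigenvector A r).2 ⟨v, hv, h⟩)

open Matrix in
/-- The largest eigenvalue of a symmetric matrix of positive size has an eigenvector. -/
lemma exists_eigenvector_largestEigenvalue {p : ℕ} (hp : 0 < p) {A : Matrix (Fin p) (Fin p) ℝ}
    (hA : A.IsHermitian) :
    ∃ v : Fin p → ℝ, v ≠ 0 ∧ A *ᵥ v = largestEigenvalue A • v := by
  rw [← isRoot_charpoly_iff_exists_eigenvector]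
  refine Set.Nonempty.csSup_mem ?_ (finite_setOf_isRoot_charpoly A)
  refine ⟨hA.eigenvalues ⟨0, hp⟩, ?_⟩
  rw [Set.mem_ofPred_eq, ← Matrix.mem_spectrum_iff_isRoot_charpoly]
  exact hA.eigenvalues_mem_spectrum_real _

open Matrix in
/-- Rayleigh's inequality. -/
lemma dotProduct_mulVec_le_largestEigenvalue {p : ℕ} {A : Matrix (Fin p) (Fin p) ℝ}
    (hA : A.IsHermitian) (y : Fin p → ℝ) :
    y ⬝ᵥ A *ᵥ y ≤ largestEigenvalue A * (y ⬝ᵥ y) := by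
  set l := largestEigenvalue A with hl
  have hB : (l • (1 : Matrix (Fin p) (Fin p) ℝ) - A).IsHermitian := by
    refine IsHermitian.sub ?_ hA
    simp [IsHermitian]
  -- A negative eigenvalue ν of l - A would make l - ν an eigenvalue of A above the largest one.
  have hpos : (l • (1 : Matrix (Fin p) (Fin p) ℝ) - A).PosSemidef := by
    rw [hB.posSemidef_iff_eigenvalues_nonneg]
    intro i
    have h1 := hB.mulVec_eigenvectorBasis i
    have h0 : (⇑(hB.eigenvectorBasis i) : Fin p → ℝ) ≠ 0 := by
      intro h
      refine hB.eigenvectorBasis.orthonormal.ne_zero i ?_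
      ext j
      exact congrFun h j
    rw [sub_mulVec, smul_mulVec, one_mulVec] at h1
    have h2 : A *ᵥ ⇑(hB.eigenvectorBasis i)
        = (l - hB.eigenvalues i) • ⇑(hB.eigenvectorBasis i) := by
      rw [sub_smul, ← h1]
      abel
    have h3 := le_largestEigenvalue h0 h2
    simp only [Pi.zero_apply]
    linarith
  have h := hpos.dotProduct_mulVec_nonneg y
  rw [star_trivial, sub_mulVec, smul_mulVec, one_mulVec, dotProduct_sub, dotProduct_smul,
    smul_eq_mul] at h
  linarith

open Matrix in
lemma largestEigenvalue_le_iff {p : ℕ} (hp : 0 < p) {A : Matrix (Fin p) (Fin p) ℝ}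
    (hA : A.IsHermitian) (t : ℝ) :
    largestEigenvalue A ≤ t ↔ ∀ y : Fin p → ℝ, y ⬝ᵥ A *ᵥ y ≤ t * (y ⬝ᵥ y) := by
  constructor
  · intro h y
    refine (dotProduct_mulVec_le_largestEigenvalue hA y).trans ?_
    exact mul_le_mul_of_nonneg_right h (real_dotProduct_self_nonneg y)
  · intro h
    obtain ⟨v, hv, hv'⟩ := exists_eigenvector_largestEigenvalue hp hA
    have h1 := h v
    rw [hv', dotProduct_smul, smul_eq_mul] at h1
    refine le_of_mul_le_mul_right h1 ?_
    exact lt_of_le_of_ne (real_dotProduct_self_nonneg v) (fun h => hv (dotProduct_self_eq_zero.1 h.symm))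

lemma isHermitian_sampleCov {p n : ℕ} (X : Matrix (Fin p) (Fin n) ℝ) :
    (sampleCov X).IsHermitian := by
  simp [sampleCov, Matrix.IsHermitian, Matrix.conjTranspose_eq_transpose_of_trivial,
    Matrix.transpose_smul, Matrix.transpose_mul]

open Matrix in
/-- The largest eigenvalue of the sample covariance matrix is a measurable function of the data. -/
lemma measurable_largestEigenvalue_sampleCov {p n : ℕ} :
    Measurable (fun f : Fin p × Fin n → ℝ =>
      largestEigenvalue (sampleCov (Matrix.of fun i j => f (i, j)))) := by
  -- The variational criterion fails for p = 0: there the supremum over the empty set is 0, while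
  -- the condition on test vectors is vacuous for every t.
  rcases Nat.eq_zero_or_pos p with rfl | hp
  · have : (fun f : Fin 0 × Fin n → ℝ =>
        largestEigenvalue (sampleCov (Matrix.of fun i j => f (i, j))))
        = fun _ => largestEigenvalue (0 : Matrix (Fin 0) (Fin 0) ℝ) := by
      funext f
      congr 1
      exact Subsingleton.elim _ _
    rw [this]
    exact measurable_const
  -- Sublevel sets are intersections of closed conditions, one per test vector; closedness makes the
  -- uncountable intersection harmless.
  · refine measurable_of_Iic fun t => IsClosed.measurableSet ?_
    have : (fun f : Fin p × Fin n → ℝ =>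
        largestEigenvalue (sampleCov (Matrix.of fun i j => f (i, j)))) ⁻¹' Set.Iic t
        = ⋂ y : Fin p → ℝ, {f | y ⬝ᵥ (sampleCov (Matrix.of fun i j => f (i, j))) *ᵥ y
            ≤ t * (y ⬝ᵥ y)} := by
      ext f
      simp only [Set.mem_preimage, Set.mem_Iic, Set.mem_iInter, Set.mem_ofPred_eq]
      exact largestEigenvalue_le_iff hp (isHermitian_sampleCov _) t
    rw [this]
    refine isClosed_iInter fun y => isClosed_le ?_ continuous_const
    simp only [sampleCov, dotProduct, mulVec, Matrix.smul_apply, Matrix.mul_apply,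
      Matrix.transpose_apply, Matrix.of_apply]
    fun_prop

/-! ### Secular inequalities for a rank-one compression -/

open Matrix in
/-- Bounds for the largest eigenvalue of a symmetric matrix in terms of its compression to a vector
`u` and to the orthogonal complement of `u`. -/
lemma largestEigenvalue_perturbation {p : ℕ} (hp : 0 < p) {A : Matrix (Fin p) (Fin p) ℝ}
    (hA : A.IsHermitian) {u b : Fin p → ℝ} {θ m : ℝ} (hu : 0 < u ⬝ᵥ u)
    (hb : A *ᵥ u = θ • u + b) (hub : u ⬝ᵥ b = 0) (hnn : ∀ y, 0 ≤ y ⬝ᵥ A *ᵥ y)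
    (hm : ∀ w, u ⬝ᵥ w = 0 → w ⬝ᵥ A *ᵥ w ≤ m * (w ⬝ᵥ w)) :
    θ ≤ largestEigenvalue A ∧
    (0 < largestEigenvalue A →
      b ⬝ᵥ b ≤ (largestEigenvalue A - θ) * largestEigenvalue A * (u ⬝ᵥ u)) ∧
    (m < largestEigenvalue A →
      (largestEigenvalue A - θ) * (largestEigenvalue A - m) * (u ⬝ᵥ u) ≤ b ⬝ᵥ b) := by
  set l := largestEigenvalue A with hl
  set s := u ⬝ᵥ u with hs
  have hbu : b ⬝ᵥ u = 0 := by rw [dotProduct_comm, hub]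
  have hsymm : ∀ y z : Fin p → ℝ, y ⬝ᵥ A *ᵥ z = (A *ᵥ y) ⬝ᵥ z := by
    intro y z
    rw [dotProduct_mulVec, ← mulVec_transpose]
    have : Aᵀ = A := by simpa [IsHermitian, conjTranspose_eq_transpose_of_trivial] using hA
    rw [this]
  have hθ : θ ≤ l := by
    have h := dotProduct_mulVec_le_largestEigenvalue hA u
    rw [hb, dotProduct_add, dotProduct_smul, hub, smul_eq_mul, add_zero] at h
    exact le_of_mul_le_mul_right h hu
  refine ⟨hθ, fun hlpos => ?_, fun hml => ?_⟩
  -- The test vector is l times u + b/l, the eigenvector u + (l - B)⁻¹b with the compression B to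
  -- the complement of u replaced by 0.
  · have h := dotProduct_mulVec_le_largestEigenvalue hA (l • u + b)
    have e1 : (l • u + b) ⬝ᵥ (l • u + b) = l ^ 2 * s + b ⬝ᵥ b := by
      simp only [dotProduct_add, add_dotProduct, dotProduct_smul, smul_dotProduct, smul_eq_mul,
        hub, hbu, ← hs]
      ring
    have e3 : b ⬝ᵥ A *ᵥ u = b ⬝ᵥ b := by
      rw [hb, dotProduct_add, dotProduct_smul, hbu, smul_zero, zero_add]
    have e4 : u ⬝ᵥ A *ᵥ b = b ⬝ᵥ b := by
      rw [hsymm, dotProduct_comm, e3]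
    have e5 : u ⬝ᵥ A *ᵥ u = θ * s := by
      rw [hb, dotProduct_add, dotProduct_smul, hub, smul_eq_mul, add_zero]
    have e2 : (l • u + b) ⬝ᵥ A *ᵥ (l • u + b)
        = l ^ 2 * (θ * s) + 2 * l * (b ⬝ᵥ b) + b ⬝ᵥ A *ᵥ b := by
      simp only [dotProduct_add, add_dotProduct, dotProduct_smul, smul_dotProduct, smul_eq_mul,
        mulVec_add, mulVec_smul, e3, e4, e5]
      ring
    rw [e1, e2] at h
    have h2 := hnn b
    have h3 : l * (b ⬝ᵥ b) ≤ l * ((l - θ) * l * s) := by linarith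
    exact le_of_mul_le_mul_left h3 hlpos
  · obtain ⟨y, hy0, hy⟩ := exists_eigenvector_largestEigenvalue hp hA
    rw [← hl] at hy
    -- Split the eigenvector as αu + w with w ⟂ u. Pairing the eigenvalue equation with u and with
    -- w, then applying Cauchy–Schwarz to b ⬝ᵥ w, eliminates w.
    set α := (u ⬝ᵥ y) / s with hα
    set w := y - α • u with hw
    have hyw : y = α • u + w := by rw [hw]; abel
    have huw : u ⬝ᵥ w = 0 := by
      rw [hw, dotProduct_sub, dotProduct_smul, ← hs, hα, smul_eq_mul, div_mul_cancel₀ _ hu.ne',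
        sub_self]
    have hwu : w ⬝ᵥ u = 0 := by rw [dotProduct_comm, huw]
    set B := b ⬝ᵥ w with hB
    have hwb : w ⬝ᵥ b = B := dotProduct_comm _ _
    have huAw : u ⬝ᵥ A *ᵥ w = B := by
      rw [hsymm, hb, add_dotProduct, smul_dotProduct, huw, smul_zero, zero_add]
    have h1 : B = (l - θ) * α * s := by
      have := congrArg (fun z => u ⬝ᵥ z) hy
      simp only [hyw, mulVec_add, mulVec_smul, hb, dotProduct_add, dotProduct_smul, huAw, hub,
        huw, smul_eq_mul, ← hs] at this
      linarith
    have h2 : l * (w ⬝ᵥ w) = α * B + w ⬝ᵥ A *ᵥ w := by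
      have := congrArg (fun z => w ⬝ᵥ z) hy
      simp only [hyw, mulVec_add, mulVec_smul, hb, dotProduct_add, dotProduct_smul, hwb, hwu,
        smul_eq_mul] at this
      linarith
    have h3 := hm w huw
    have hcs : B ^ 2 ≤ (b ⬝ᵥ b) * (w ⬝ᵥ w) := by
      simp only [hB, dotProduct, ← sq]
      exact Finset.sum_mul_sq_le_sq_mul_sq _ _ _
    have h4 : (l - m) * (w ⬝ᵥ w) ≤ (l - θ) * (α ^ 2 * s) := by
      calc (l - m) * (w ⬝ᵥ w) ≤ α * B := by linarith
        _ = _ := by rw [h1]; ring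
    have hbb := real_dotProduct_self_nonneg b
    have hww := real_dotProduct_self_nonneg w
    have hα0 : α ≠ 0 := by
      intro h0
      rw [h0] at h4
      have hw0 : w ⬝ᵥ w = 0 := by
        refine le_antisymm ?_ hww
        refine nonpos_of_mul_nonpos_right ?_ (sub_pos.2 hml)
        simpa using h4
      rw [dotProduct_self_eq_zero] at hw0
      exact hy0 (by rw [hyw, h0, hw0]; simp)
    rcases hθ.eq_or_lt with h0 | h0
    · rw [h0]; simpa using hbb
    · have hpos : 0 < (l - θ) * (α ^ 2 * s) := by
        have := sub_pos.2 h0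
        positivity
      refine le_of_mul_le_mul_right ?_ hpos
      calc (l - θ) * (l - m) * s * ((l - θ) * (α ^ 2 * s)) = (l - m) * B ^ 2 := by rw [h1]; ring
        _ ≤ (l - m) * ((b ⬝ᵥ b) * (w ⬝ᵥ w)) :=
          mul_le_mul_of_nonneg_left hcs (sub_pos.2 hml).le
        _ = (b ⬝ᵥ b) * ((l - m) * (w ⬝ᵥ w)) := by ring
        _ ≤ _ := mul_le_mul_of_nonneg_left h4 hbb

/-! ### Statistics of the noise and the structure of the sample covariance -/

/-- The `i`-th row sum of the array `g`. -/
noncomputable def rowTotal {p n : ℕ} (g : Fin p × Fin n → ℝ) (i : Fin p) : ℝ := ∑ k, g (i, k)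

/-- The sum of all the entries of the array `g`. -/
noncomputable def total {p n : ℕ} (g : Fin p × Fin n → ℝ) : ℝ := ∑ i, rowTotal g i

/-- The `(i, j)` entry of `g gᵀ - n I`. -/
noncomputable def gramDev {p n : ℕ} (g : Fin p × Fin n → ℝ) (i j : Fin p) : ℝ :=
  ∑ k, g (i, k) * g (j, k) - if i = j then (n : ℝ) else 0

/-- The `i`-th row sum of `g gᵀ - n I`. -/
noncomputable def gramDevRow {p n : ℕ} (g : Fin p × Fin n → ℝ) (i : Fin p) : ℝ :=
  ∑ j, gramDev g i j

/-- The sum of all entries of `g gᵀ - n I`. -/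
noncomputable def gramDevTotal {p n : ℕ} (g : Fin p × Fin n → ℝ) : ℝ := ∑ i, gramDevRow g i

/-- The matrix with entries `μ + σ g (i, j)`. -/
noncomputable def dataMatrix (μ σ : ℝ) {p n : ℕ} (g : Fin p × Fin n → ℝ) :
    Matrix (Fin p) (Fin n) ℝ :=
  Matrix.of fun i j => μ + σ * g (i, j)

lemma sum_mul_colTotal {p n : ℕ} (g : Fin p × Fin n → ℝ) (i : Fin p) :
    ∑ j, ∑ k, g (i, k) * g (j, k) = gramDevRow g i + n := by
  simp [gramDevRow, gramDev, Finset.sum_sub_distrib]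

/-- Separates the part independent of i from the final bracket; centring that bracket gives the
component b of Wu orthogonal to the constants. -/
lemma sampleCov_rowSum (μ σ : ℝ) {p n : ℕ} (hn : 0 < n) (g : Fin p × Fin n → ℝ) (i : Fin p) :
    ∑ j, sampleCov (dataMatrix μ σ g) i j
      = p * μ ^ 2 + μ * σ * total g / n + σ ^ 2
        + σ / n * (p * μ * rowTotal g i + σ * gramDevRow g i) := by
  have hn' : (n : ℝ) ≠ 0 := by positivity
  have h : ∀ j, sampleCov (dataMatrix μ σ g) i j
      = μ ^ 2 + μ * σ / n * rowTotal g j + μ * σ / n * rowTotal g i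
        + σ ^ 2 / n * ∑ k, g (i, k) * g (j, k) := by
    intro j
    simp only [sampleCov, dataMatrix, Matrix.smul_apply, Matrix.mul_apply, Matrix.transpose_apply,
      Matrix.of_apply, smul_eq_mul]
    have : ∀ k, (μ + σ * g (i, k)) * (μ + σ * g (j, k))
        = μ ^ 2 + μ * σ * g (j, k) + μ * σ * g (i, k) + σ ^ 2 * (g (i, k) * g (j, k)) := by
      intro k; ring
    simp only [this, Finset.sum_add_distrib, ← Finset.mul_sum, rowTotal, Finset.sum_const,
      Finset.card_univ, Fintype.card_fin, nsmul_eq_mul]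
    field_simp
  simp only [h, Finset.sum_add_distrib, ← Finset.mul_sum, sum_mul_colTotal, total,
    Finset.sum_const, Finset.card_univ, Fintype.card_fin, nsmul_eq_mul]
  field_simp
  ring

lemma avgRowSum_sampleCov (μ σ : ℝ) {p n : ℕ} (hp : 0 < p) (hn : 0 < n)
    (g : Fin p × Fin n → ℝ) :
    avgRowSum (sampleCov (dataMatrix μ σ g))
      = p * μ ^ 2 + 2 * μ * σ * total g / n + σ ^ 2 + σ ^ 2 * gramDevTotal g / (p * n) := by
  have hn' : (n : ℝ) ≠ 0 := by positivity
  have hp' : (p : ℝ) ≠ 0 := by positivity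
  simp only [avgRowSum, sampleCov_rowSum μ σ hn, Finset.sum_add_distrib, ← Finset.mul_sum,
    total, gramDevTotal, Finset.sum_const, Finset.card_univ, Fintype.card_fin, nsmul_eq_mul]
  field_simp
  ring

open Matrix in
lemma dotProduct_sampleCov_mulVec {p n : ℕ} (X : Matrix (Fin p) (Fin n) ℝ) (y : Fin p → ℝ) :
    y ⬝ᵥ sampleCov X *ᵥ y = (n : ℝ)⁻¹ * ((Xᵀ *ᵥ y) ⬝ᵥ (Xᵀ *ᵥ y)) := by
  rw [sampleCov, smul_mulVec, dotProduct_smul, smul_eq_mul, ← mulVec_mulVec, dotProduct_mulVec,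
    ← mulVec_transpose]

open Matrix in
lemma dotProduct_sampleCov_mulVec_nonneg {p n : ℕ} (X : Matrix (Fin p) (Fin n) ℝ)
    (y : Fin p → ℝ) : 0 ≤ y ⬝ᵥ sampleCov X *ᵥ y := by
  rw [dotProduct_sampleCov_mulVec]
  have := real_dotProduct_self_nonneg (Xᵀ *ᵥ y)
  positivity

open Matrix in
/-- On the orthogonal complement of the constant vectors the quadratic form of the sample
covariance matrix is controlled by the Frobenius norm of `g gᵀ - n I`. -/
lemma dotProduct_sampleCov_mulVec_le (μ σ : ℝ) {p n : ℕ} (hn : 0 < n) (g : Fin p × Fin n → ℝ)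
    {τ : ℝ} (hτ : 0 ≤ τ) (hT : ∑ i, ∑ j, gramDev g i j ^ 2 ≤ τ ^ 2) (w : Fin p → ℝ)
    (hw : (fun _ => (1 : ℝ)) ⬝ᵥ w = 0) :
    w ⬝ᵥ sampleCov (dataMatrix μ σ g) *ᵥ w ≤ σ ^ 2 * (n + τ) / n * (w ⬝ᵥ w) := by
  have hw' : ∑ i, w i = 0 := by simpa [dotProduct] using hw
  -- Orthogonality to the constants removes the mean μ.
  have h1 : (dataMatrix μ σ g)ᵀ *ᵥ w = σ • fun k => ∑ i, g (i, k) * w i := by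
    funext k
    simp only [mulVec, dotProduct, transpose_apply, dataMatrix, of_apply, add_mul,
      Finset.sum_add_distrib, ← Finset.mul_sum, hw', mul_zero, zero_add, Pi.smul_apply, smul_eq_mul,
      mul_assoc]
  have h2 : (fun k => ∑ i, g (i, k) * w i) ⬝ᵥ (fun k => ∑ i, g (i, k) * w i)
      = n * (w ⬝ᵥ w) + ∑ i, ∑ j, gramDev g i j * (w i * w j) := by
    have e : ∀ i j, gramDev g i j * (w i * w j)
        = ∑ k, g (i, k) * w i * (g (j, k) * w j) - if i = j then n * (w i * w j) else 0 := by
      intro i j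
      rw [gramDev, sub_mul, Finset.sum_mul, ite_mul, zero_mul]
      congr 1
      exact Finset.sum_congr rfl fun k _ => by ring
    simp only [e, Finset.sum_sub_distrib, Finset.sum_ite_eq, Finset.mem_univ, if_true,
      dotProduct, Finset.sum_mul_sum, ← Finset.mul_sum]
    rw [add_sub_cancel]
    simp only [← Finset.sum_mul_sum, Finset.sum_mul, Finset.mul_sum]
    rw [Finset.sum_comm]
    refine Finset.sum_congr rfl fun i _ => ?_
    rw [Finset.sum_comm]
    exact Finset.sum_congr rfl fun j _ => Finset.sum_congr rfl fun k _ => mul_comm _ _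
  -- Cauchy–Schwarz over index pairs, that is, operator norm at most Frobenius norm. This is lossy,
  -- but order x√p suffices against an eigenvalue of order p.
  have h3 : ∑ i, ∑ j, gramDev g i j * (w i * w j) ≤ τ * (w ⬝ᵥ w) := by
    refine le_of_sq_le_sq ?_ (mul_nonneg hτ (real_dotProduct_self_nonneg w))
    simp only [← Fintype.sum_prod_type'] at hT ⊢
    refine (Finset.sum_mul_sq_le_sq_mul_sq _ _ _).trans ?_
    rw [mul_pow]
    have : ∑ x : Fin p × Fin p, (w x.1 * w x.2) ^ 2 = (w ⬝ᵥ w) ^ 2 := by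
      rw [Fintype.sum_prod_type, sq, dotProduct, Finset.sum_mul_sum]
      exact Finset.sum_congr rfl fun i _ => Finset.sum_congr rfl fun j _ => by ring
    rw [this]
    exact mul_le_mul_of_nonneg_right hT (sq_nonneg _)
  rw [dotProduct_sampleCov_mulVec, h1, smul_dotProduct, dotProduct_smul, h2, smul_eq_mul,
    smul_eq_mul]
  calc (n : ℝ)⁻¹ * (σ * (σ * (n * (w ⬝ᵥ w) + ∑ i, ∑ j, gramDev g i j * (w i * w j))))
      = (n : ℝ)⁻¹ * σ ^ 2 * (n * (w ⬝ᵥ w) + ∑ i, ∑ j, gramDev g i j * (w i * w j)) := by ring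
    _ ≤ (n : ℝ)⁻¹ * σ ^ 2 * (n * (w ⬝ᵥ w) + τ * (w ⬝ᵥ w)) := by gcongr
    _ = _ := by ring

/-! ### Deterministic estimate on the typical event -/

/-- Solving the secular inequalities for the shift of a large eigenvalue. -/
lemma abs_shift_sub_le {a A s k D D₂ D₃ p δ η θ m β : ℝ} (ha : 0 < a) (hA : a ≤ A) (hs : 0 < s)
    (hk : 0 < k) (hD : 0 ≤ D) (hD₂ : 0 ≤ D₂) (hD₃ : 0 ≤ D₃) (hp : 0 < p) (hδ : 0 < δ)
    (hδ₁ : δ ≤ 1) (hδp : 1 ≤ δ * p) (hβ : |β - s * a * k * p| ≤ D * a * p * δ)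
    (hθ : |θ - k * p| ≤ D₂ * (δ * p)) (hm : m ≤ D₃ * (δ * p)) (hsmall : (D₂ + D₃) * δ ≤ k / 2)
    (hη : 0 ≤ η) (hu : m < θ + η → η * (θ + η - m) ≤ β)
    (hl : 0 < θ + η → β ≤ η * (θ + η)) :
    |η - s * a| ≤
      (D + 2 * (s * k + D) / k * (D₂ + D₃ + A * (2 * (s * k + D) / k))) / k * δ * a := by
  -- The a priori bound η ≤ aE comes from θ + η - m ≥ kp/2 and β ≤ (sk + D)ap. It is then fed back:
  -- replacing θ + η by kp in the secular inequalities costs only a relative error of order δ.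
  set E := 2 * (s * k + D) / k with hE
  have hE0 : 0 ≤ E := by positivity
  have hA0 : 0 ≤ A := ha.le.trans hA
  obtain ⟨hβ₁, hβ₂⟩ := abs_le.1 hβ
  obtain ⟨hθ₁, hθ₂⟩ := abs_le.1 hθ
  have hkp : 0 < k * p := mul_pos hk hp
  have h1 : (D₂ + D₃) * δ * p ≤ k / 2 * p := by gcongr
  have h2 : k * p / 2 ≤ θ - m := by linarith
  have h2' : k * p / 2 ≤ θ := by
    have : 0 ≤ D₃ * (δ * p) := by positivity
    linarith
  have hu' := hu (by linarith)
  have hl' := hl (by linarith)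
  have h3 : η ≤ a * E := by
    have e1 : η * (k * p / 2) ≤ β := le_trans (by gcongr; linarith) hu'
    have e2 : D * a * p * δ ≤ D * a * p * 1 := by gcongr
    have e3 : η * (k * p / 2) ≤ (a * E) * (k * p / 2) := by
      have : (a * E) * (k * p / 2) = s * a * k * p + D * a * p := by rw [hE]; field_simp
      linarith
    exact le_of_mul_le_mul_right e3 (by positivity)
  have hδp0 : 0 < δ * p := mul_pos hδ hp
  rw [abs_le]
  constructor
  · have e1 : η * (k * p - θ - η) ≥ -(a * E * (D₂ * (δ * p) + A * E * (δ * p))) := by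
      have f1 : η ≤ A * E * (δ * p) := by
        calc η ≤ a * E * 1 := by linarith
          _ ≤ A * E * (δ * p) := by gcongr
      have f2 : η * (D₂ * (δ * p) + η) ≤ a * E * (D₂ * (δ * p) + A * E * (δ * p)) := by gcongr
      have f3 : η * (θ + η - k * p) ≤ η * (D₂ * (δ * p) + η) := by gcongr; linarith
      linarith
    have e2 : (s * a - η) * (k * p) ≤ (D + E * (D₂ + D₃ + A * E)) * δ * a * p := by
      have : 0 ≤ E * D₃ * δ * a * p := by positivity
      linarith
    have e3 : (s * a - η) * (k * p)
        ≤ ((D + E * (D₂ + D₃ + A * E)) / k * δ * a) * (k * p) := by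
      refine e2.trans (le_of_eq ?_)
      field_simp
    linarith [le_of_mul_le_mul_right e3 hkp]
  · have e1 : η * (k * p - θ - η + m) ≤ a * E * ((D₂ + D₃) * (δ * p)) := by
      calc η * (k * p - θ - η + m) ≤ η * ((D₂ + D₃) * (δ * p)) := by gcongr; linarith
        _ ≤ _ := by gcongr
    have e2 : (η - s * a) * (k * p) ≤ (D + E * (D₂ + D₃ + A * E)) * δ * a * p := by
      have : 0 ≤ E * (A * E) * δ * a * p := by
        positivity
      linarith
    have e3 : (η - s * a) * (k * p)
        ≤ ((D + E * (D₂ + D₃ + A * E)) / k * δ * a) * (k * p) := by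
      refine e2.trans (le_of_eq ?_)
      field_simp
    exact le_of_mul_le_mul_right e3 hkp

/-- The event that the linear and quadratic statistics of `g` exceed their typical size by a factor
of at most `x`. -/
structure IsTypical {p n : ℕ} (x : ℝ) (g : Fin p × Fin n → ℝ) : Prop where
  rowTotal_sq : (∑ i, rowTotal g i ^ 2 - p * n) ^ 2 ≤ x ^ 2 * (p * n ^ 2)
  total_sq : total g ^ 2 ≤ x ^ 2 * (p * n)
  gramDevTotal_sq : gramDevTotal g ^ 2 ≤ x ^ 2 * (p ^ 2 * n)
  gramDevRow_sq : ∑ i, gramDevRow g i ^ 2 ≤ x ^ 2 * (p ^ 2 * n)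
  gramDev_sq : ∑ i, ∑ j, gramDev g i j ^ 2 ≤ x ^ 2 * (p ^ 2 * n)

/-- Up to the factor (σ/n)² this estimates |b|². The leading term is p²μ² times the sum of squared
row totals, itself about pn; the cross term is handled by Cauchy–Schwarz. -/
lemma IsTypical.abs_norm_sq_sub_le {μ σ : ℝ} (hμ : 0 < μ) (hσ : 0 < σ) {p n : ℕ} (hp : 0 < p)
    {x : ℝ} (hx : 1 ≤ x) (hxp : x ≤ √p) {g : Fin p × Fin n → ℝ}
    (h : IsTypical x g) :
    |∑ i, (p * μ * rowTotal g i + σ * gramDevRow g i) ^ 2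
        - (p * μ * total g + σ * gramDevTotal g) ^ 2 / p - p ^ 3 * n * μ ^ 2|
      ≤ (3 * μ ^ 2 + 4 * μ * σ + 3 * σ ^ 2) * (x * √p * p ^ 2 * n) := by
  obtain ⟨hr, hS, hH, hh, -⟩ := h
  have hpp : (0 : ℝ) < p := by positivity
  set q := √(p : ℝ) with hq
  have hq0 : 0 < q := Real.sqrt_pos.2 hpp
  have hqp : (p : ℝ) = q ^ 2 := (Real.sq_sqrt hpp.le).symm
  set R := ∑ i, rowTotal g i ^ 2
  set M := ∑ i, rowTotal g i * gramDevRow g i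
  set N := ∑ i, gramDevRow g i ^ 2
  have hn0 : (0 : ℝ) ≤ n := by positivity
  have hx0 : 0 < x := by linarith
  have e1 : ∑ i, (p * μ * rowTotal g i + σ * gramDevRow g i) ^ 2
      = p ^ 2 * μ ^ 2 * R + 2 * p * μ * σ * M + σ ^ 2 * N := by
    simp only [R, M, N, Finset.mul_sum, ← Finset.sum_add_distrib]
    exact Finset.sum_congr rfl fun i _ => by ring
  have hr' : |R - p * n| ≤ x * q * n := by
    refine abs_le_of_sq_le_sq (hr.trans (le_of_eq ?_)) (by positivity)
    rw [hqp]; ring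
  have hM : |M| ≤ 2 * (x * q ^ 3 * n) := by
    refine abs_le_of_sq_le_sq ?_ (by positivity)
    have hR : R ≤ 2 * (p * n) := by
      have : x * q * n ≤ q * q * n := by gcongr
      have := (abs_le.1 hr').2
      rw [hqp] at this ⊢
      linarith
    calc M ^ 2 ≤ R * N := Finset.sum_mul_sq_le_sq_mul_sq _ _ _
      _ ≤ (2 * (p * n)) * (x ^ 2 * (p ^ 2 * n)) :=
        mul_le_mul hR hh (Finset.sum_nonneg fun i _ => sq_nonneg _) (by positivity)
      _ = 2 * (x * q ^ 3 * n) ^ 2 := by rw [hqp]; ring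
      _ ≤ 4 * (x * q ^ 3 * n) ^ 2 := by gcongr; norm_num
      _ = _ := by ring
  -- Quadratic errors in x are absorbed through x ≤ √p, so every error has the common unit x q⁵ n.
  have hxq : x ^ 2 * q ^ 4 * n ≤ x * q ^ 5 * n := by
    calc x ^ 2 * q ^ 4 * n = x * q ^ 4 * n * x := by ring
      _ ≤ x * q ^ 4 * n * q := by gcongr
      _ = _ := by ring
  have hN : N ≤ x * q ^ 5 * n := by
    refine hh.trans (le_trans (le_of_eq ?_) hxq)
    rw [hqp]; ring
  have hN0 : 0 ≤ N := Finset.sum_nonneg fun i _ => sq_nonneg _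
  have hZ : (p * μ * total g + σ * gramDevTotal g) ^ 2 / p
      ≤ 2 * (μ ^ 2 + σ ^ 2) * (x * q ^ 5 * n) := by
    rw [div_le_iff₀ hpp]
    have hp1 : (1 : ℝ) ≤ p := by exact_mod_cast hp
    calc (p * μ * total g + σ * gramDevTotal g) ^ 2
        ≤ 2 * (p ^ 2 * μ ^ 2 * total g ^ 2 + σ ^ 2 * gramDevTotal g ^ 2) := by
          linarith [sq_nonneg (p * μ * total g - σ * gramDevTotal g)]
      _ ≤ 2 * (p ^ 2 * μ ^ 2 * (x ^ 2 * (p * n)) + σ ^ 2 * (x ^ 2 * (p ^ 2 * n))) := by gcongr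
      _ ≤ 2 * (p ^ 2 * μ ^ 2 * (x ^ 2 * (p * n)) + σ ^ 2 * (x ^ 2 * (p ^ 2 * p * n))) := by
          gcongr
          exact le_mul_of_one_le_right (by positivity) hp1
      _ = 2 * (μ ^ 2 + σ ^ 2) * (x ^ 2 * q ^ 4 * n) * p := by rw [hqp]; ring
      _ ≤ _ := by gcongr
  have hZ0 : 0 ≤ (p * μ * total g + σ * gramDevTotal g) ^ 2 / p := by positivity
  have f1 : p ^ 2 * μ ^ 2 * |R - p * n| ≤ μ ^ 2 * (x * q ^ 5 * n) := by
    calc p ^ 2 * μ ^ 2 * |R - p * n| ≤ p ^ 2 * μ ^ 2 * (x * q * n) := by gcongr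
      _ = _ := by rw [hqp]; ring
  have f2 : 2 * p * μ * σ * |M| ≤ 4 * μ * σ * (x * q ^ 5 * n) := by
    calc 2 * p * μ * σ * |M| ≤ 2 * p * μ * σ * (2 * (x * q ^ 3 * n)) := by gcongr
      _ = _ := by rw [hqp]; ring
  have f3 : σ ^ 2 * N ≤ σ ^ 2 * (x * q ^ 5 * n) := by gcongr
  have f4 : 0 ≤ σ ^ 2 * N := by positivity
  have g1 : |p ^ 2 * μ ^ 2 * (R - p * n)| ≤ μ ^ 2 * (x * q ^ 5 * n) := by
    rw [abs_mul, abs_of_nonneg (by positivity : (0 : ℝ) ≤ p ^ 2 * μ ^ 2)]; exact f1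
  have g2 : |2 * p * μ * σ * M| ≤ 4 * μ * σ * (x * q ^ 5 * n) := by
    rw [abs_mul, abs_of_nonneg (by positivity : (0 : ℝ) ≤ 2 * p * μ * σ)]; exact f2
  have e2 : x * q * p ^ 2 * n = x * q ^ 5 * n := by rw [hqp]; ring
  rw [e1, e2]
  rw [abs_le] at g1 g2 ⊢
  constructor <;> linarith [g1.1, g1.2, g2.1, g2.2]

open Matrix in
/-- On the typical event, `λ₁(W)` is close to its linear approximation. -/
lemma IsTypical.abs_avgRowSum_sub_le {μ σ c : ℝ} (hμ : 0 < μ) (hσ : 0 < σ) (hc : 0 < c)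
    {p n : ℕ} (hp : 0 < p) (hn : 0 < n) (hpn : (p : ℝ) / n ≤ 2 * c)
    {x : ℝ} (hx : 1 ≤ x) (hxp : x ≤ √p)
    (hsmall : ((2 * μ * σ + 2 * σ ^ 2) + σ ^ 2 * (2 + 2 * c)) * x ≤ μ ^ 2 / 2 * √p)
    {g : Fin p × Fin n → ℝ} (h : IsTypical x g) :
    |avgRowSum (sampleCov (dataMatrix μ σ g)) + p * σ ^ 2 / n
        - largestEigenvalue (sampleCov (dataMatrix μ σ g))|
      ≤ (σ ^ 2 * (3 * μ ^ 2 + 4 * μ * σ + 3 * σ ^ 2)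
          + 2 * (σ ^ 2 * μ ^ 2 + σ ^ 2 * (3 * μ ^ 2 + 4 * μ * σ + 3 * σ ^ 2)) / μ ^ 2
            * ((2 * μ * σ + 2 * σ ^ 2) + σ ^ 2 * (2 + 2 * c) + 2 * c
              * (2 * (σ ^ 2 * μ ^ 2 + σ ^ 2 * (3 * μ ^ 2 + 4 * μ * σ + 3 * σ ^ 2)) / μ ^ 2)))
          / μ ^ 2 * √p * x / n := by
  have hpp : (0 : ℝ) < p := by positivity
  have hnn : (0 : ℝ) < n := by positivity
  have hp1 : (1 : ℝ) ≤ p := by exact_mod_cast hp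
  have hn1 : (1 : ℝ) ≤ n := by exact_mod_cast hn
  set q := √(p : ℝ) with hq
  have hq0 : 0 < q := Real.sqrt_pos.2 hpp
  have hqp : (p : ℝ) = q ^ 2 := (Real.sq_sqrt hpp.le).symm
  set r := √(n : ℝ) with hr
  have hr0 : 0 < r := Real.sqrt_pos.2 hnn
  have hrn : (n : ℝ) = r ^ 2 := (Real.sq_sqrt hnn.le).symm
  have hr1 : 1 ≤ r := Real.one_le_sqrt.2 hn1
  have hq1 : 1 ≤ q := Real.one_le_sqrt.2 hp1
  have hx0 : 0 < x := by linarith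
  set W := sampleCov (dataMatrix μ σ g) with hW
  set l := largestEigenvalue W with hl
  set θ := avgRowSum W with hθ
  have hθ' := avgRowSum_sampleCov μ σ hp hn g
  rw [← hW, ← hθ] at hθ'
  set z : Fin p → ℝ := fun i => p * μ * rowTotal g i + σ * gramDevRow g i with hz
  set Z := p * μ * total g + σ * gramDevTotal g with hZ
  have hzZ : ∑ i, z i = Z := by
    simp only [hz, hZ, Finset.sum_add_distrib, ← Finset.mul_sum, total, gramDevTotal]
  set b : Fin p → ℝ := fun i => σ / n * (z i - Z / p) with hb
  set τ := x * p * r with hτ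
  set m := σ ^ 2 * (n + τ) / n with hm
  have huu : (fun _ : Fin p => (1 : ℝ)) ⬝ᵥ (fun _ => 1) = p := by simp [dotProduct]
  have hAu : W *ᵥ (fun _ => 1) = θ • (fun _ => 1) + b := by
    funext i
    have := sampleCov_rowSum μ σ hn g i
    simp only [mulVec, dotProduct, mul_one, Pi.add_apply, Pi.smul_apply, smul_eq_mul, hb, hθ', hz,
      hZ]
    rw [hW, this]
    field_simp
    ring
  have hub : (fun _ : Fin p => (1 : ℝ)) ⬝ᵥ b = 0 := by
    simp only [dotProduct, one_mul, hb, ← Finset.mul_sum, Finset.sum_sub_distrib, hzZ,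
      Finset.sum_const, Finset.card_univ, Fintype.card_fin, nsmul_eq_mul]
    field_simp
    simp
  have hbb : b ⬝ᵥ b = (σ / n) ^ 2 * (∑ i, z i ^ 2 - Z ^ 2 / p) := by
    have : ∀ i, b i * b i = (σ / n) ^ 2 * (z i ^ 2 - 2 * (Z / p) * z i + (Z / p) ^ 2) := by
      intro i; simp only [hb]; ring
    simp only [dotProduct, this, ← Finset.mul_sum, Finset.sum_sub_distrib, Finset.sum_add_distrib,
      hzZ, Finset.sum_const, Finset.card_univ, Fintype.card_fin, nsmul_eq_mul]
    field_simp
    ring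
  have hpert := largestEigenvalue_perturbation hp (isHermitian_sampleCov (dataMatrix μ σ g))
    (u := fun _ => 1) (b := b) (θ := θ) (m := m) (by rw [huu]; exact hpp) hAu hub
    (dotProduct_sampleCov_mulVec_nonneg _)
    (fun w hw => dotProduct_sampleCov_mulVec_le μ σ hn g (by positivity)
      (h.gramDev_sq.trans (le_of_eq (by rw [hτ, hrn]; ring))) w hw)
  rw [huu, ← hW, ← hl] at hpert
  obtain ⟨hp1', hp2, hp3⟩ := hpert
  have hS : |total g| ≤ x * q * r := by
    refine abs_le_of_sq_le_sq (h.total_sq.trans (le_of_eq ?_)) (by positivity)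
    rw [hqp, hrn]; ring
  have hH : |gramDevTotal g| ≤ x * p * r := by
    refine abs_le_of_sq_le_sq (h.gramDevTotal_sq.trans (le_of_eq ?_)) (by positivity)
    rw [hrn]; ring
  have hδp : x / q * p = x * q := by rw [hqp]; field_simp
  -- The predicted shift is sa = σ²p/n, the leading eigenvalue is kp = μ²p, and δ = x/√p is the
  -- relative error of every statistic.
  have key := abs_shift_sub_le (a := p / n) (A := 2 * c) (s := σ ^ 2) (k := μ ^ 2)
    (D := σ ^ 2 * (3 * μ ^ 2 + 4 * μ * σ + 3 * σ ^ 2)) (D₂ := 2 * μ * σ + 2 * σ ^ 2)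
    (D₃ := σ ^ 2 * (2 + 2 * c)) (p := p) (δ := x / q) (η := l - θ) (θ := θ) (m := m)
    (β := b ⬝ᵥ b / p) (by positivity) hpn (by positivity) (by positivity) (by positivity)
    (by positivity) (by positivity) hpp (by positivity) ((div_le_one hq0).2 hxp)
    (by rw [hδp]; exact one_le_mul_of_one_le_of_one_le hx hq1) ?_ ?_ ?_ ?_ (by linarith) ?_ ?_
  · rw [abs_sub_comm] at key
    have e1 : θ + p * σ ^ 2 / n - l = σ ^ 2 * (p / n) - (l - θ) := by ring
    rw [e1]
    refine key.trans (le_of_eq ?_)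
    have e2 : x / q * (p / n) = q * x / n := by rw [hqp]; field_simp
    rw [mul_assoc _ (x / q), e2]
    ring
  · have h1 := h.abs_norm_sq_sub_le hμ hσ hp hx hxp
    rw [← hq] at h1
    have e1 : b ⬝ᵥ b / p - σ ^ 2 * (p / n) * μ ^ 2 * p
        = σ ^ 2 / (n ^ 2 * p) * (∑ i, z i ^ 2 - Z ^ 2 / p - p ^ 3 * n * μ ^ 2) := by
      rw [hbb]; field_simp
    rw [e1, abs_mul, abs_of_nonneg (by positivity : (0 : ℝ) ≤ σ ^ 2 / (n ^ 2 * p))]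
    calc _ ≤ σ ^ 2 / (n ^ 2 * p)
          * ((3 * μ ^ 2 + 4 * μ * σ + 3 * σ ^ 2) * (x * q * p ^ 2 * n)) := by gcongr
      _ = _ := by rw [hqp]; field_simp
  · rw [hδp, hθ']
    have e1 : p * μ ^ 2 + 2 * μ * σ * total g / n + σ ^ 2 + σ ^ 2 * gramDevTotal g / (p * n)
        - μ ^ 2 * p = 2 * μ * σ / n * total g + σ ^ 2 + σ ^ 2 / (p * n) * gramDevTotal g := by
      field_simp; ring
    have hxq : 1 ≤ x * q := one_le_mul_of_one_le_of_one_le hx hq1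
    have t1 : |2 * μ * σ / n * total g| ≤ 2 * μ * σ * (x * q) := by
      rw [abs_mul, abs_of_nonneg (by positivity : 0 ≤ 2 * μ * σ / n)]
      calc 2 * μ * σ / n * |total g| ≤ 2 * μ * σ / n * (x * q * r) := by gcongr
        _ = 2 * μ * σ * (x * q) / r := by rw [hrn]; field_simp
        _ ≤ _ := div_le_self (by positivity) hr1
    have t2 : |σ ^ 2 / (p * n) * gramDevTotal g| ≤ σ ^ 2 * (x * q) := by
      rw [abs_mul, abs_of_nonneg (by positivity : 0 ≤ σ ^ 2 / (p * n))]
      calc σ ^ 2 / (p * n) * |gramDevTotal g| ≤ σ ^ 2 / (p * n) * (x * p * r) := by gcongr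
        _ = σ ^ 2 * x / r := by rw [hrn]; field_simp
        _ ≤ σ ^ 2 * x := div_le_self (by positivity) hr1
        _ ≤ σ ^ 2 * (x * q) := by gcongr; exact le_mul_of_one_le_right hx0.le hq1
    have t3 : |σ ^ 2| ≤ σ ^ 2 * (x * q) := by
      rw [abs_of_nonneg (by positivity)]
      exact le_mul_of_one_le_right (by positivity) hxq
    rw [e1]
    refine (abs_add_three _ _ _).trans ?_
    linarith
  · rw [hδp]
    have e1 : m = σ ^ 2 * (1 + x * (p / n * r)) := by rw [hm, hτ]; field_simp
    have hpr : p / n * r ≤ (1 + 2 * c) * q := by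
      have hqr : p / n * r = q / r * q := by rw [hqp, hrn]; field_simp
      rw [hqr]
      have : q / r ≤ 1 + 2 * c := by
        have h1 : (q / r) ^ 2 ≤ 2 * c := by rw [div_pow, ← hqp, ← hrn]; exact hpn
        nlinarith [sq_nonneg (q / r - 1)]
      gcongr
    have hxq : 1 ≤ x * q := one_le_mul_of_one_le_of_one_le hx hq1
    rw [e1, mul_assoc]
    gcongr
    calc 1 + x * (p / n * r) ≤ x * q + x * ((1 + 2 * c) * q) := by gcongr
      _ = _ := by ring
  · rw [← mul_div_assoc, div_le_iff₀ hq0]; exact hsmall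
  · intro hlt
    rw [add_sub_cancel] at hlt ⊢
    rw [le_div_iff₀ hpp]
    exact hp3 hlt
  · intro hlt
    rw [add_sub_cancel] at hlt ⊢
    rw [div_le_iff₀ hpp]
    exact hp2 hlt

/-! ### Moments of Gaussian quadratic forms -/

lemma integrable_pow_gaussianReal (k : ℕ) : Integrable (fun x : ℝ => x ^ k) (gaussianReal 0 1) := by
  rcases Nat.eq_zero_or_pos k with rfl | hk
  · simp
  · have := (memLp_id_gaussianReal (μ := 0) (v := 1) k).integrable_norm_pow hk.ne'
    refine (integrable_norm_iff (by fun_prop)).1 ?_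
    simpa using this

/-- The standard Gaussian measure on `ι → ℝ`. -/
noncomputable abbrev gaussianPi (ι : Type*) [Fintype ι] : Measure (ι → ℝ) :=
  Measure.pi fun _ => gaussianReal 0 1

section Moments

variable {ι : Type*} [Fintype ι]

lemma integrable_prod_pow_gaussianPi (m : ι → ℕ) :
    Integrable (fun g : ι → ℝ => ∏ e, g e ^ m e) (gaussianPi ι) :=
  Integrable.fintype_prod (f := fun e (x : ℝ) => x ^ m e) fun _ => integrable_pow_gaussianReal _

lemma integral_prod_pow_gaussianPi (m : ι → ℕ) :
    ∫ g, ∏ e, g e ^ m e ∂gaussianPi ι = ∏ e, ∫ x, x ^ m e ∂gaussianReal 0 1 :=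
  integral_fintype_prod_eq_prod (fun e (x : ℝ) => x ^ m e)

variable [DecidableEq ι]

lemma prod_pow_ite_eq (g : ι → ℝ) (a : ι) : ∏ e, g e ^ (if e = a then 1 else 0) = g a := by
  simp

/-- As a monomial over all coordinates, the product integrates factor by factor whatever
coincidences there are among the indices. -/
lemma mul_mul_mul_eq_prod_pow (g : ι → ℝ) (a b c d : ι) :
    g a * g b * (g c * g d) = ∏ e, g e ^ ((if e = a then 1 else 0) + (if e = b then 1 else 0)
      + ((if e = c then 1 else 0) + (if e = d then 1 else 0))) := by
  simp only [pow_add, Finset.prod_mul_distrib, prod_pow_ite_eq]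

lemma mul_eq_prod_pow (g : ι → ℝ) (a b : ι) :
    g a * g b = ∏ e, g e ^ ((if e = a then 1 else 0) + (if e = b then 1 else 0)) := by
  simp only [pow_add, Finset.prod_mul_distrib, prod_pow_ite_eq]

lemma integrable_mul_gaussianPi (a b : ι) :
    Integrable (fun g : ι → ℝ => g a * g b) (gaussianPi ι) := by
  simp only [mul_eq_prod_pow]
  exact integrable_prod_pow_gaussianPi _

lemma integrable_mul_mul_mul_gaussianPi (a b c d : ι) :
    Integrable (fun g : ι → ℝ => g a * g b * (g c * g d)) (gaussianPi ι) := by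
  simp only [mul_mul_mul_eq_prod_pow]
  exact integrable_prod_pow_gaussianPi _

lemma integral_sq_gaussianReal : ∫ x : ℝ, x ^ 2 ∂gaussianReal 0 1 = 1 := by
  have h := variance_id_gaussianReal (μ := 0) (v := 1)
  rw [variance_eq_integral (by fun_prop)] at h
  simpa using h

lemma integral_mul_gaussianPi (a b : ι) :
    ∫ g, g a * g b ∂gaussianPi ι = if a = b then 1 else 0 := by
  simp only [mul_eq_prod_pow]
  rw [integral_prod_pow_gaussianPi]
  split_ifs with h
  · subst h
    refine Finset.prod_eq_one fun e _ => ?_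
    split_ifs
    · exact integral_sq_gaussianReal
    · simp
  · refine Finset.prod_eq_zero (Finset.mem_univ a) ?_
    simp [h]

/-- A fourth mixed moment in which one variable occurs exactly once vanishes. -/
lemma integral_mul_mul_mul_gaussianPi_eq_zero {a b c d : ι} (hb : a ≠ b) (hc : a ≠ c)
    (hd : a ≠ d) : ∫ g, g a * g b * (g c * g d) ∂gaussianPi ι = 0 := by
  simp only [mul_mul_mul_eq_prod_pow]
  rw [integral_prod_pow_gaussianPi]
  refine Finset.prod_eq_zero (Finset.mem_univ a) ?_
  simp [hb, hc, hd]

lemma integral_sq_mul_sq_gaussianPi {a c : ι} (hc : a ≠ c) :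
    ∫ g, g a * g a * (g c * g c) ∂gaussianPi ι = 1 := by
  simp only [mul_mul_mul_eq_prod_pow]
  rw [integral_prod_pow_gaussianPi]
  refine Finset.prod_eq_one fun e _ => ?_
  by_cases h : e = a
  · subst h
    simpa [hc] using integral_sq_gaussianReal
  · by_cases h' : e = c
    · subst h'
      simpa [h] using integral_sq_gaussianReal
    · simp [h, h']

lemma integral_pow_four_gaussianPi (a : ι) :
    ∫ g, g a * g a * (g a * g a) ∂gaussianPi ι = ∫ x : ℝ, x ^ 4 ∂gaussianReal 0 1 := by
  simp only [mul_mul_mul_eq_prod_pow]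
  rw [integral_prod_pow_gaussianPi]
  refine (Finset.prod_eq_single a (fun e _ h => ?_) (by simp)).trans ?_
  · simp [h]
  · simp

/-- The fourth mixed moments of independent standard Gaussian variables. -/
lemma integral_mul_mul_mul_gaussianPi (a b c d : ι) :
    ∫ g, g a * g b * (g c * g d) ∂gaussianPi ι
      = (if a = b then 1 else 0) * (if c = d then 1 else 0)
        + (if a = c then 1 else 0) * (if b = d then 1 else 0)
        + (if a = d then 1 else 0) * (if b = c then 1 else 0)
        + (∫ x : ℝ, x ^ 4 ∂gaussianReal 0 1 - 3)
          * (if a = b ∧ a = c ∧ a = d then 1 else 0) := by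
  by_cases hab : a = b
  · subst hab
    by_cases hcd : c = d
    · subst hcd
      by_cases hac : a = c
      · subst hac
        rw [integral_pow_four_gaussianPi]
        simp only [if_true, and_self]
        ring
      · rw [integral_sq_mul_sq_gaussianPi hac]
        simp [hac]
    · by_cases hac : a = c
      · subst hac
        -- The index occurring exactly once is moved to the front, where the vanishing lemma expects
        -- it.
        have h : ∀ g : ι → ℝ, g a * g a * (g a * g d) = g d * g a * (g a * g a) :=
          fun g => by ring
        simp only [h]
        rw [integral_mul_mul_mul_gaussianPi_eq_zero (Ne.symm hcd) (Ne.symm hcd) (Ne.symm hcd)]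
        simp [hcd]
      · have h : ∀ g : ι → ℝ, g a * g a * (g c * g d) = g c * g a * (g a * g d) :=
          fun g => by ring
        simp only [h]
        rw [integral_mul_mul_mul_gaussianPi_eq_zero (Ne.symm hac) (Ne.symm hac) hcd]
        simp [hcd, hac]
  · by_cases hac : a = c
    · subst hac
      by_cases hbd : b = d
      · subst hbd
        have h : ∀ g : ι → ℝ, g a * g b * (g a * g b) = g a * g a * (g b * g b) :=
          fun g => by ring
        simp only [h]
        rw [integral_sq_mul_sq_gaussianPi hab]
        simp [hab]
      · have h : ∀ g : ι → ℝ, g a * g b * (g a * g d) = g b * g a * (g a * g d) :=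
          fun g => by ring
        simp only [h]
        rw [integral_mul_mul_mul_gaussianPi_eq_zero (Ne.symm hab) (Ne.symm hab) hbd]
        simp [hab, hbd, Ne.symm hab]
    · by_cases had : a = d
      · subst had
        by_cases hbc : b = c
        · subst hbc
          have h : ∀ g : ι → ℝ, g a * g b * (g b * g a) = g a * g a * (g b * g b) :=
            fun g => by ring
          simp only [h]
          rw [integral_sq_mul_sq_gaussianPi hab]
          simp [hab]
        · have h : ∀ g : ι → ℝ, g a * g b * (g c * g a) = g b * g a * (g c * g a) :=
            fun g => by ring
          simp only [h]
          rw [integral_mul_mul_mul_gaussianPi_eq_zero (Ne.symm hab) hbc (Ne.symm hab)]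
          simp [hab, hbc, hac]
      · rw [integral_mul_mul_mul_gaussianPi_eq_zero hab hac had]
        simp [hab, hac, had]

/-- The centred quadratic form with coefficients `A`. -/
noncomputable def centredForm (A : ι → ι → ℝ) (g : ι → ℝ) : ℝ :=
  ∑ a, ∑ b, A a b * (g a * g b - if a = b then 1 else 0)

lemma integrable_centred_mul (a b c d : ι) (s t : ℝ) :
    Integrable (fun g : ι → ℝ => (g a * g b - s) * (g c * g d - t)) (gaussianPi ι) := by
  have h : ∀ g : ι → ℝ, (g a * g b - s) * (g c * g d - t)
      = g a * g b * (g c * g d) - t * (g a * g b) - (s * (g c * g d) - s * t) := fun g => by ring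
  simp only [h]
  exact ((integrable_mul_mul_mul_gaussianPi a b c d).sub
    ((integrable_mul_gaussianPi a b).const_mul t)).sub
    (((integrable_mul_gaussianPi c d).const_mul s).sub (integrable_const (s * t)))

lemma integral_sub_mul_sub (a b c d : ι) (s t : ℝ) :
    ∫ g : ι → ℝ, (g a * g b - s) * (g c * g d - t) ∂gaussianPi ι
      = ∫ g : ι → ℝ, g a * g b * (g c * g d) ∂gaussianPi ι - t * (if a = b then 1 else 0)
        - (s * (if c = d then 1 else 0) - s * t) := by
  have h : ∀ g : ι → ℝ, (g a * g b - s) * (g c * g d - t)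
      = g a * g b * (g c * g d) - t * (g a * g b) - (s * (g c * g d) - s * t) := fun g => by ring
  have i₁ := integrable_mul_mul_mul_gaussianPi a b c d
  have i₂ := (integrable_mul_gaussianPi a b).const_mul t
  have i₃ := (integrable_mul_gaussianPi c d).const_mul s
  simp only [h]
  have i₁₂ : Integrable (fun g : ι → ℝ => g a * g b * (g c * g d) - t * (g a * g b))
    (gaussianPi ι) := i₁.sub i₂
  have i₃₄ : Integrable (fun g : ι → ℝ => s * (g c * g d) - s * t) (gaussianPi ι) :=
    i₃.sub (integrable_const _)
  rw [integral_sub i₁₂ i₃₄, integral_sub i₁ i₂,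
    integral_sub i₃ (integrable_const _), integral_const_mul, integral_const_mul,
    integral_mul_gaussianPi, integral_mul_gaussianPi]
  simp

/-- Centring cancels the pairing of a with b and c with d, the only one that would make the second
moment of a form exceed the order of its squared Frobenius norm. -/
lemma integral_centred_mul (a b c d : ι) :
    ∫ g : ι → ℝ, (g a * g b - if a = b then 1 else 0)
      * (g c * g d - if c = d then 1 else 0) ∂gaussianPi ι
      = (if a = c then 1 else 0) * (if b = d then 1 else 0)
        + (if a = d then 1 else 0) * (if b = c then 1 else 0)
        + (∫ x : ℝ, x ^ 4 ∂gaussianReal 0 1 - 3)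
          * (if a = b ∧ a = c ∧ a = d then 1 else 0) := by
  rw [integral_sub_mul_sub, integral_mul_mul_mul_gaussianPi]
  ring

lemma centredForm_sq (A : ι → ι → ℝ) (g : ι → ℝ) :
    centredForm A g ^ 2 = ∑ a, ∑ b, ∑ c, ∑ d, A a b * A c d *
      ((g a * g b - if a = b then 1 else 0) * (g c * g d - if c = d then 1 else 0)) := by
  simp only [sq, centredForm, Finset.sum_mul, Finset.mul_sum]
  refine Finset.sum_congr rfl fun a _ => Finset.sum_congr rfl fun b _ =>
    Finset.sum_congr rfl fun c _ => Finset.sum_congr rfl fun d _ => by ring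

lemma integrable_centredForm_sq (A : ι → ι → ℝ) :
    Integrable (fun g => centredForm A g ^ 2) (gaussianPi ι) := by
  simp only [centredForm_sq]
  exact integrable_finsetSum _ fun a _ => integrable_finsetSum _ fun b _ =>
    integrable_finsetSum _ fun c _ => integrable_finsetSum _ fun d _ =>
      (integrable_centred_mul a b c d _ _).const_mul _

/-- A constant bounding the variance of a Gaussian quadratic form in terms of the Frobenius norm of
its coefficients. -/
noncomputable def formConst : ℝ := 2 + |∫ x : ℝ, x ^ 4 ∂gaussianReal 0 1 - 3|

lemma two_le_formConst : 2 ≤ formConst := le_add_of_nonneg_right (abs_nonneg _)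

/-- The two surviving pairings give the squared Frobenius norm and tr A², which is no larger by 2xy
≤ x² + y²; the fourth-cumulant term sees only the diagonal. The fourth moment need not be evaluated,
and A need not be symmetric. -/
lemma integral_centredForm_sq_le (A : ι → ι → ℝ) :
    ∫ g, centredForm A g ^ 2 ∂gaussianPi ι ≤ formConst * ∑ a, ∑ b, A a b ^ 2 := by
  set κ := ∫ x : ℝ, x ^ 4 ∂gaussianReal 0 1 - 3 with hκ
  have e : ∫ g, centredForm A g ^ 2 ∂gaussianPi ι
      = ∑ a, ∑ b, A a b ^ 2 + ∑ a, ∑ b, A a b * A b a + κ * ∑ a, A a a ^ 2 := by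
    simp only [centredForm_sq]
    rw [integral_finsetSum _ fun a _ => integrable_finsetSum _ fun b _ =>
      integrable_finsetSum _ fun c _ => integrable_finsetSum _ fun d _ =>
        (integrable_centred_mul a b c d _ _).const_mul _]
    rw [Finset.mul_sum, ← Finset.sum_add_distrib, ← Finset.sum_add_distrib]
    refine Finset.sum_congr rfl fun a _ => ?_
    rw [integral_finsetSum _ fun b _ =>
      integrable_finsetSum _ fun c _ => integrable_finsetSum _ fun d _ =>
        (integrable_centred_mul a b c d _ _).const_mul _]
    have h : ∀ b, ∫ g, ∑ c, ∑ d, A a b * A c d *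
      ((g a * g b - if a = b then 1 else 0) * (g c * g d - if c = d then 1 else 0)) ∂gaussianPi ι
        = A a b ^ 2 + A a b * A b a + if a = b then κ * A a a ^ 2 else 0 := by
      intro b
      rw [integral_finsetSum _ fun c _ => integrable_finsetSum _ fun d _ =>
        (integrable_centred_mul a b c d _ _).const_mul _]
      have h2 : ∀ c, ∫ g, ∑ d, A a b * A c d *
          ((g a * g b - if a = b then 1 else 0) * (g c * g d - if c = d then 1 else 0)) ∂gaussianPi ι
          = (if a = c then A a b * A c b else 0) + (if b = c then A a b * A c a else 0)
            + if a = c then (if a = b then κ * (A a b * A c a) else 0) else 0 := by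
        intro c
        rw [integral_finsetSum _ fun d _ => (integrable_centred_mul a b c d _ _).const_mul _]
        simp only [integral_const_mul, integral_centred_mul, mul_add, Finset.sum_add_distrib]
        congr 1
        · congr 1
          · split_ifs <;> simp
          · split_ifs <;> simp
        · rw [← hκ]
          by_cases h1 : a = b
          · by_cases h3 : a = c
            · subst h1
              subst h3
              simp [mul_comm]
            · simp [h3]
          · simp [h1]
      simp only [h2, Finset.sum_add_distrib, Finset.sum_ite_eq, Finset.mem_univ, if_true]
      congr 1
      · ring
      · split_ifs with h3
        · subst h3; ring
        · rfl
    simp only [h, Finset.sum_add_distrib, Finset.sum_ite_eq, Finset.mem_univ, if_true]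
  have h1 : ∑ a, ∑ b, A a b * A b a ≤ ∑ a, ∑ b, A a b ^ 2 := by
    have h2 : ∑ a, ∑ b, A b a ^ 2 = ∑ a, ∑ b, A a b ^ 2 := Finset.sum_comm
    have h3 : ∑ a, ∑ b, A a b * A b a ≤ ∑ a, ∑ b, (A a b ^ 2 / 2 + A b a ^ 2 / 2) :=
      Finset.sum_le_sum fun a _ => Finset.sum_le_sum fun b _ => by
        linarith [sq_nonneg (A a b - A b a)]
    simp only [Finset.sum_add_distrib, ← Finset.sum_div, h2] at h3
    linarith
  have h2 : ∑ a, A a a ^ 2 ≤ ∑ a, ∑ b, A a b ^ 2 :=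
    Finset.sum_le_sum fun a _ =>
      Finset.single_le_sum (f := fun b => A a b ^ 2) (fun b _ => sq_nonneg _) (Finset.mem_univ a)
  have h3 : κ * ∑ a, A a a ^ 2 ≤ |κ| * ∑ a, ∑ b, A a b ^ 2 :=
    mul_le_mul (le_abs_self κ) h2 (Finset.sum_nonneg fun a _ => sq_nonneg _) (abs_nonneg κ)
  rw [e, formConst, ← hκ]
  linarith

end Moments

/-! ### Probability of the typical event -/

/-- With 0/1 coefficients the squared Frobenius norm is a count of index pairs, so the variance
bound becomes combinatorial. -/
lemma gramDev_eq_centredForm {p n : ℕ} (g : Fin p × Fin n → ℝ) (i j : Fin p) :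
    gramDev g i j = centredForm
      (fun a b => if a.1 = i then (if b.1 = j then (if a.2 = b.2 then 1 else 0) else 0) else 0) g := by
  simp only [centredForm, Fintype.sum_prod_type, ite_mul, zero_mul, one_mul,
    Finset.sum_ite_eq, Finset.mem_univ, if_true, Finset.sum_ite_irrel, Finset.sum_const_zero,
    Finset.sum_ite_eq', Prod.mk.injEq, and_true, gramDev, Finset.sum_sub_distrib]
  simp

lemma gramDevRow_eq_centredForm {p n : ℕ} (g : Fin p × Fin n → ℝ) (i : Fin p) :
    gramDevRow g i = centredForm
      (fun a b => if a.1 = i then (if a.2 = b.2 then 1 else 0) else 0) g := by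
  simp only [centredForm, Fintype.sum_prod_type, ite_mul, zero_mul, one_mul,
    Finset.sum_ite_eq, Finset.mem_univ, if_true, Finset.sum_ite_irrel, Finset.sum_const_zero,
    Finset.sum_ite_eq', Prod.mk.injEq, and_true, gramDevRow, gramDev, Finset.sum_sub_distrib]
  rw [Finset.sum_comm]
  simp

lemma gramDevTotal_eq_centredForm {p n : ℕ} (g : Fin p × Fin n → ℝ) :
    gramDevTotal g = centredForm (fun a b => if a.2 = b.2 then 1 else 0) g := by
  simp only [centredForm, Fintype.sum_prod_type, ite_mul, zero_mul, one_mul,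
    Finset.sum_ite_eq, Finset.mem_univ, if_true, Prod.mk.injEq, and_true, gramDevTotal, gramDevRow,
    gramDev]
  refine Finset.sum_congr rfl fun i _ => ?_
  rw [Finset.sum_comm]
  simp [Finset.sum_sub_distrib]

lemma sum_rowTotal_sq_sub_eq_centredForm {p n : ℕ} (g : Fin p × Fin n → ℝ) :
    ∑ i, rowTotal g i ^ 2 - p * n = centredForm (fun a b => if a.1 = b.1 then 1 else 0) g := by
  simp only [centredForm, Fintype.sum_prod_type, ite_mul, zero_mul, one_mul,
    Finset.sum_ite_irrel, Finset.sum_const_zero, Finset.sum_ite_eq, Finset.mem_univ, if_true,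
    Prod.mk.injEq, true_and, rowTotal, sq, Finset.sum_mul_sum, Finset.sum_sub_distrib]
  simp

lemma total_eq_sum {p n : ℕ} (g : Fin p × Fin n → ℝ) : total g = ∑ a, g a := by
  simp only [total, rowTotal, Fintype.sum_prod_type]

lemma total_sq_eq_sum {p n : ℕ} (g : Fin p × Fin n → ℝ) :
    total g ^ 2 = ∑ a, ∑ b, g a * g b := by
  rw [total_eq_sum, sq, Finset.sum_mul_sum]

lemma integrable_total_sq {p n : ℕ} :
    Integrable (fun g : Fin p × Fin n → ℝ => total g ^ 2) (gaussianPi (Fin p × Fin n)) := by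
  simp only [total_sq_eq_sum]
  exact integrable_finsetSum _ fun a _ => integrable_finsetSum _ fun b _ =>
    integrable_mul_gaussianPi a b

lemma integral_total_sq {p n : ℕ} :
    ∫ g : Fin p × Fin n → ℝ, total g ^ 2 ∂gaussianPi (Fin p × Fin n) = p * n := by
  simp only [total_sq_eq_sum]
  rw [integral_finsetSum _ fun a _ => integrable_finsetSum _ fun b _ =>
    integrable_mul_gaussianPi a b]
  simp only [integral_finsetSum _ fun b _ => integrable_mul_gaussianPi _ b, integral_mul_gaussianPi]
  simp

lemma measureReal_lt_le_of_integral_le {α : Type*} {mα : MeasurableSpace α} {ν : Measure α}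
    [IsFiniteMeasure ν]
    {f : α → ℝ} (hf : Integrable f ν) (hnn : ∀ a, 0 ≤ f a) {K B x : ℝ} (hB : 0 < B) (hx : 0 < x)
    (h : ∫ a, f a ∂ν ≤ K * B) : ν.real {a | x ^ 2 * B < f a} ≤ K / x ^ 2 := by
  have h1 := mul_meas_ge_le_integral_of_nonneg (ae_of_all _ hnn) hf (x ^ 2 * B)
  have h2 : ν.real {a | x ^ 2 * B < f a} ≤ ν.real {a | x ^ 2 * B ≤ f a} :=
    measureReal_mono (Set.ofPred_subset_ofPred.2 fun a ha => le_of_lt ha)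
  have h3 : x ^ 2 * B * ν.real {a | x ^ 2 * B < f a} ≤ K * B :=
    (mul_le_mul_of_nonneg_left h2 (by positivity)).trans (h1.trans h)
  rw [le_div_iff₀ (by positivity)]
  refine le_of_mul_le_mul_right ?_ hB
  linarith

/-- The typical event at level `x` fails with probability `O(x⁻²)`. -/
lemma measureReal_not_isTypical_le {p n : ℕ} (hp : 0 < p) (hn : 0 < n) {x : ℝ} (hx : 0 < x) :
    (gaussianPi (Fin p × Fin n)).real {g | ¬ IsTypical x g} ≤ 5 * formConst / x ^ 2 := by
  have hpp : (0 : ℝ) < p := by positivity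
  have hnn : (0 : ℝ) < n := by positivity
  have hK := two_le_formConst
  set γ := gaussianPi (Fin p × Fin n)
  have m1 : γ.real {g | x ^ 2 * (p * n ^ 2) < (∑ i, rowTotal g i ^ 2 - p * n) ^ 2}
      ≤ formConst / x ^ 2 := by
    refine measureReal_lt_le_of_integral_le ?_ (fun _ => sq_nonneg _) (by positivity) hx ?_
    · simp only [sum_rowTotal_sq_sub_eq_centredForm]
      exact integrable_centredForm_sq _
    · simp only [sum_rowTotal_sq_sub_eq_centredForm]
      refine (integral_centredForm_sq_le _).trans (le_of_eq ?_)
      congr 1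
      simp only [ite_pow, one_pow, zero_pow two_ne_zero, Fintype.sum_prod_type]
      change (∑ x : Fin p, ∑ _ : Fin n, ∑ x' : Fin p, ∑ _ : Fin n, if x = x' then (1 : ℝ) else 0) = _
      simp [sq]
  have m2 : γ.real {g | x ^ 2 * (p * n) < total g ^ 2} ≤ formConst / x ^ 2 := by
    refine measureReal_lt_le_of_integral_le integrable_total_sq (fun _ => sq_nonneg _)
      (by positivity) hx ?_
    rw [integral_total_sq]
    exact le_mul_of_one_le_left (by positivity) (by linarith)
  have m3 : γ.real {g | x ^ 2 * (p ^ 2 * n) < gramDevTotal g ^ 2} ≤ formConst / x ^ 2 := by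
    refine measureReal_lt_le_of_integral_le ?_ (fun _ => sq_nonneg _) (by positivity) hx ?_
    · simp only [gramDevTotal_eq_centredForm]
      exact integrable_centredForm_sq _
    · simp only [gramDevTotal_eq_centredForm]
      refine (integral_centredForm_sq_le _).trans (le_of_eq ?_)
      congr 1
      simp only [ite_pow, one_pow, zero_pow two_ne_zero, Fintype.sum_prod_type]
      change (∑ _ : Fin p, ∑ k : Fin n, ∑ _ : Fin p, ∑ l : Fin n, if k = l then (1 : ℝ) else 0) = _
      simp
      ring
  have m4 : γ.real {g | x ^ 2 * (p ^ 2 * n) < ∑ i, gramDevRow g i ^ 2} ≤ formConst / x ^ 2 := by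
    have hi : ∀ i, Integrable (fun g : Fin p × Fin n → ℝ => gramDevRow g i ^ 2) γ := by
      intro i
      simp only [gramDevRow_eq_centredForm]
      exact integrable_centredForm_sq _
    refine measureReal_lt_le_of_integral_le (integrable_finsetSum _ fun i _ => hi i)
      (fun _ => Finset.sum_nonneg fun _ _ => sq_nonneg _) (by positivity) hx ?_
    rw [integral_finsetSum _ fun i _ => hi i]
    have h : ∀ i, ∫ g, gramDevRow g i ^ 2 ∂γ ≤ formConst * (p * n) := by
      intro i
      simp only [gramDevRow_eq_centredForm]
      refine (integral_centredForm_sq_le _).trans (le_of_eq ?_)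
      congr 1
      simp only [ite_pow, one_pow, zero_pow two_ne_zero, Fintype.sum_prod_type]
      change (∑ x : Fin p, ∑ k : Fin n, ∑ _ : Fin p, ∑ l : Fin n,
        if x = i then if k = l then (1 : ℝ) else 0 else 0) = _
      simp [Finset.sum_ite_irrel]
      ring
    refine (Finset.sum_le_sum fun i _ => h i).trans (le_of_eq ?_)
    simp
    ring
  have m5 : γ.real {g | x ^ 2 * (p ^ 2 * n) < ∑ i, ∑ j, gramDev g i j ^ 2}
      ≤ formConst / x ^ 2 := by
    have hi : ∀ i j, Integrable (fun g : Fin p × Fin n → ℝ => gramDev g i j ^ 2) γ := by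
      intro i j
      simp only [gramDev_eq_centredForm]
      exact integrable_centredForm_sq _
    refine measureReal_lt_le_of_integral_le
      (integrable_finsetSum _ fun i _ => integrable_finsetSum _ fun j _ => hi i j)
      (fun _ => Finset.sum_nonneg fun _ _ => Finset.sum_nonneg fun _ _ => sq_nonneg _)
      (by positivity) hx ?_
    rw [integral_finsetSum _ fun i _ => integrable_finsetSum _ fun j _ => hi i j]
    simp only [integral_finsetSum _ fun j _ => hi _ j]
    have h : ∀ i j, ∫ g, gramDev g i j ^ 2 ∂γ ≤ formConst * n := by
      intro i j
      simp only [gramDev_eq_centredForm]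
      refine (integral_centredForm_sq_le _).trans (le_of_eq ?_)
      congr 1
      simp only [ite_pow, one_pow, zero_pow two_ne_zero, Fintype.sum_prod_type]
      change (∑ x : Fin p, ∑ k : Fin n, ∑ y : Fin p, ∑ l : Fin n,
        if x = i then if y = j then if k = l then (1 : ℝ) else 0 else 0 else 0) = _
      simp [Finset.sum_ite_irrel]
    refine (Finset.sum_le_sum fun i _ => Finset.sum_le_sum fun j _ => h i j).trans (le_of_eq ?_)
    simp
    ring
  have hsub : {g : Fin p × Fin n → ℝ | ¬ IsTypical x g} ⊆
      {g | x ^ 2 * (p * n ^ 2) < (∑ i, rowTotal g i ^ 2 - p * n) ^ 2} ∪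
      ({g | x ^ 2 * (p * n) < total g ^ 2} ∪ ({g | x ^ 2 * (p ^ 2 * n) < gramDevTotal g ^ 2} ∪
      ({g | x ^ 2 * (p ^ 2 * n) < ∑ i, gramDevRow g i ^ 2} ∪
      {g | x ^ 2 * (p ^ 2 * n) < ∑ i, ∑ j, gramDev g i j ^ 2}))) := by
    intro g hg
    by_contra hc
    simp only [Set.mem_union, Set.mem_ofPred_eq, not_or, not_lt] at hc
    exact hg ⟨hc.1, hc.2.1, hc.2.2.1, hc.2.2.2.1, hc.2.2.2.2⟩
  refine (measureReal_mono hsub).trans ?_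
  have u1 := measureReal_union_le (μ := γ)
    {g | x ^ 2 * (p * n ^ 2) < (∑ i, rowTotal g i ^ 2 - p * n) ^ 2}
    ({g | x ^ 2 * (p * n) < total g ^ 2} ∪ ({g | x ^ 2 * (p ^ 2 * n) < gramDevTotal g ^ 2} ∪
      ({g | x ^ 2 * (p ^ 2 * n) < ∑ i, gramDevRow g i ^ 2} ∪
      {g | x ^ 2 * (p ^ 2 * n) < ∑ i, ∑ j, gramDev g i j ^ 2})))
  have u2 := measureReal_union_le (μ := γ) {g | x ^ 2 * (p * n) < total g ^ 2}
    ({g | x ^ 2 * (p ^ 2 * n) < gramDevTotal g ^ 2} ∪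
      ({g | x ^ 2 * (p ^ 2 * n) < ∑ i, gramDevRow g i ^ 2} ∪
      {g | x ^ 2 * (p ^ 2 * n) < ∑ i, ∑ j, gramDev g i j ^ 2}))
  have u3 := measureReal_union_le (μ := γ) {g | x ^ 2 * (p ^ 2 * n) < gramDevTotal g ^ 2}
    ({g | x ^ 2 * (p ^ 2 * n) < ∑ i, gramDevRow g i ^ 2} ∪
      {g | x ^ 2 * (p ^ 2 * n) < ∑ i, ∑ j, gramDev g i j ^ 2})
  have u4 := measureReal_union_le (μ := γ) {g | x ^ 2 * (p ^ 2 * n) < ∑ i, gramDevRow g i ^ 2}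
    {g | x ^ 2 * (p ^ 2 * n) < ∑ i, ∑ j, gramDev g i j ^ 2}
  have e : 5 * formConst / x ^ 2 = formConst / x ^ 2 + (formConst / x ^ 2 + (formConst / x ^ 2
      + (formConst / x ^ 2 + formConst / x ^ 2))) := by ring
  rw [e]
  linarith

/-! ### Tail bound for the approximation error -/

/-- Existential form of the comparison between `λ₁(W)` and its linear approximation. -/
lemma exists_approx_const {μ σ c : ℝ} (hμ : 0 < μ) (hσ : 0 < σ) (hc : 0 < c) :
    ∃ C ε : ℝ, 0 < C ∧ 0 < ε ∧ ∀ (p n : ℕ), 0 < p → 0 < n → (p : ℝ) / n ≤ 2 * c →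
      ∀ x : ℝ, 1 ≤ x → x ≤ ε * √p → ∀ g : Fin p × Fin n → ℝ, IsTypical x g →
      |avgRowSum (sampleCov (dataMatrix μ σ g)) + p * σ ^ 2 / n
        - largestEigenvalue (sampleCov (dataMatrix μ σ g))| ≤ C * √p * x / n := by
  have hB : 0 < (2 * μ * σ + 2 * σ ^ 2) + σ ^ 2 * (2 + 2 * c) := by positivity
  -- The first entry of the minimum ensures x ≤ √p, the second the smallness condition that keeps m
  -- well below θ.
  refine ⟨_, min 1 (μ ^ 2 / 2 / ((2 * μ * σ + 2 * σ ^ 2) + σ ^ 2 * (2 + 2 * c))), ?_,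
    lt_min one_pos (by positivity), fun p n hp hn hpn x hx hxp g hg =>
      hg.abs_avgRowSum_sub_le hμ hσ hc hp hn hpn hx ?_ ?_⟩
  · positivity
  · refine hxp.trans (mul_le_of_le_one_left (Real.sqrt_nonneg _) (min_le_left _ _))
  · have h := hxp.trans (mul_le_mul_of_nonneg_right (min_le_right _ _) (Real.sqrt_nonneg _))
    calc _ ≤ ((2 * μ * σ + 2 * σ ^ 2) + σ ^ 2 * (2 + 2 * c))
          * (μ ^ 2 / 2 / ((2 * μ * σ + 2 * σ ^ 2) + σ ^ 2 * (2 + 2 * c)) * √p) := by gcongr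
      _ = _ := by field_simp

/-- The tail bound for the approximation error, for a matrix of independent Gaussian entries. -/
lemma exists_tail_bound {μ σ c : ℝ} (hμ : 0 < μ) (hσ : 0 < σ) (hc : 0 < c) :
    ∃ C₁ C₂ C₃ : ℝ, 0 < C₁ ∧ 0 < C₂ ∧ 0 < C₃ ∧ ∀ (p n : ℕ), 0 < p → 0 < n →
      (p : ℝ) / n ≤ 2 * c → ∀ x : ℝ, 0 < x →
      (gaussianPi (Fin p × Fin n)).real {g | C₁ * √p * x / n <
        |avgRowSum (sampleCov (dataMatrix μ σ g)) + p * σ ^ 2 / n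
          - largestEigenvalue (sampleCov (dataMatrix μ σ g))|} < C₂ / x ^ 2 + C₃ / p := by
  obtain ⟨C, ε, hC, hε, h⟩ := exists_approx_const hμ hσ hc
  have hK := two_le_formConst
  -- The extra 1 makes the inequality strict; the third constant is the Chebyshev bound at level
  -- ε√p, multiplied by p.
  refine ⟨C, 5 * formConst + 1, 5 * formConst / ε ^ 2, hC, by linarith, by positivity,
    fun p n hp hn hpn x hx => ?_⟩
  have hpp : (0 : ℝ) < p := by positivity
  have hnn : (0 : ℝ) < n := by positivity
  have hq : 0 < √(p : ℝ) := Real.sqrt_pos.2 hpp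
  set γ := gaussianPi (Fin p × Fin n)
  have hC3 : 0 < 5 * formConst / ε ^ 2 / p := by positivity
  have hC2 : 0 < (5 * formConst + 1) / x ^ 2 := by positivity
  have hbd : ∀ y, 1 ≤ y → y ≤ ε * √p → y ≤ x → γ.real {g | C * √p * x / n <
      |avgRowSum (sampleCov (dataMatrix μ σ g)) + p * σ ^ 2 / n
        - largestEigenvalue (sampleCov (dataMatrix μ σ g))|} ≤ 5 * formConst / y ^ 2 := by
    intro y hy hyp hyx
    refine le_trans (measureReal_mono (Set.ofPred_subset_ofPred.2 fun g hg hty => ?_))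
      (measureReal_not_isTypical_le hp hn (by linarith : 0 < y))
    have h1 := h p n hp hn hpn y hy hyp g hty
    have h2 : C * √p * y / n ≤ C * √p * x / n := by gcongr
    linarith
  -- For x < 1, or for ε√p < 1 ≤ x, the right side already exceeds 1. Otherwise the typical event is
  -- used at level min(x, ε√p).
  rcases lt_or_ge x 1 with hx1 | hx1
  · refine lt_of_le_of_lt measureReal_le_one ?_
    have : 1 < (5 * formConst + 1) / x ^ 2 := by
      rw [lt_div_iff₀ (by positivity)]
      nlinarith
    linarith
  · rcases le_or_gt x (ε * √p) with hxp | hxp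
    · have h1 := hbd x hx1 hxp le_rfl
      have h2 : 5 * formConst / x ^ 2 < (5 * formConst + 1) / x ^ 2 := by gcongr; linarith
      linarith
    · rcases lt_or_ge (ε * √p) 1 with he | he
      · refine lt_of_le_of_lt measureReal_le_one ?_
        have h1 : ε ^ 2 * p < 1 := by
          rw [← Real.sq_sqrt hpp.le, ← mul_pow]
          exact pow_lt_one₀ (by positivity) he two_ne_zero
        have : 1 < 5 * formConst / ε ^ 2 / p := by
          rw [div_div, lt_div_iff₀ (by positivity)]
          linarith
        linarith
      · have h1 := hbd _ he le_rfl hxp.le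
        rw [mul_pow, Real.sq_sqrt hpp.le, ← div_div] at h1
        linarith

/-! ### Convergence of characteristic functions -/

lemma norm_cexp_sub_cexp_le (s t : ℝ) :
    ‖Complex.exp (s * Complex.I) - Complex.exp (t * Complex.I)‖ ≤ |s - t| := by
  have h : Complex.exp (s * Complex.I) - Complex.exp (t * Complex.I)
      = Complex.exp (t * Complex.I) * (Complex.exp (Complex.I * (s - t : ℝ)) - 1) := by
    rw [mul_sub, ← Complex.exp_add, mul_one]
    congr 2
    push_cast
    ring
  rw [h, norm_mul, Complex.norm_exp_ofReal_mul_I, one_mul]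
  simpa using Real.norm_exp_I_mul_ofReal_sub_one_le (x := s - t)

/-- Two random variables that are close in probability have close characteristic functions. -/
lemma norm_charFun_map_sub_le {α : Type*} {mα : MeasurableSpace α} {ν : Measure α}
    [IsProbabilityMeasure ν] {F A : α → ℝ} (hF : Measurable F) (hA : Measurable A) (t : ℝ)
    {δ : ℝ} (hδ : 0 ≤ δ) :
    ‖charFun (ν.map F) t - charFun (ν.map A) t‖
      ≤ |t| * δ + 2 * ν.real {a | δ < |F a - A a|} := by
  have hcont : Measurable (fun x : ℝ => Complex.exp (t * x * Complex.I)) := by fun_prop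
  have hint : ∀ {G : α → ℝ}, Measurable G →
      Integrable (fun a => Complex.exp (t * G a * Complex.I)) ν := by
    intro G hG
    refine Integrable.of_bound (by fun_prop) 1 (ae_of_all _ fun a => ?_)
    have := Complex.norm_exp_ofReal_mul_I (t * G a)
    push_cast at this
    exact this.le
  rw [charFun_apply_real, charFun_apply_real, integral_map hF.aemeasurable (by fun_prop),
    integral_map hA.aemeasurable (by fun_prop), ← integral_sub (hint hF) (hint hA)]
  have hS : MeasurableSet {a | δ < |F a - A a|} :=
    measurableSet_lt measurable_const (by fun_prop)
  have hi : Integrable (fun a => |t| * δ + {a | δ < |F a - A a|}.indicator (fun _ => (2 : ℝ)) a) ν :=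
    (integrable_const _).add ((integrable_const _).indicator hS)
  refine (norm_integral_le_of_norm_le hi (ae_of_all _ fun a => ?_)).trans (le_of_eq ?_)
  · by_cases ha : δ < |F a - A a|
    · have hm : a ∈ {a | δ < |F a - A a|} := ha
      rw [Set.indicator_of_mem hm]
      have h1 := Complex.norm_exp_ofReal_mul_I (t * F a)
      have h2 := Complex.norm_exp_ofReal_mul_I (t * A a)
      push_cast at h1 h2
      have h3 := norm_sub_le (Complex.exp (t * F a * Complex.I)) (Complex.exp (t * A a * Complex.I))
      have h4 : 0 ≤ |t| * δ := by positivity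
      linarith
    · have hm : a ∉ {a | δ < |F a - A a|} := ha
      rw [Set.indicator_of_notMem hm, add_zero]
      have h1 := norm_cexp_sub_cexp_le (t * F a) (t * A a)
      push_cast at h1
      refine h1.trans ?_
      rw [← mul_sub, abs_mul]
      exact mul_le_mul_of_nonneg_left (not_lt.1 ha) (abs_nonneg t)
  · rw [integral_add (integrable_const _) ((integrable_const _).indicator hS),
      integral_indicator hS]
    simp [mul_comm]

lemma charFun_map_const_mul_sum_gaussianPi {ι : Type*} [Fintype ι] (s t : ℝ) :
    charFun ((gaussianPi ι).map fun g => s * ∑ a, g a) t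
      = Complex.exp (-(s ^ 2 * Fintype.card ι * t ^ 2 / 2 : ℝ)) := by
  rw [charFun_apply_real, integral_map (by fun_prop) (by fun_prop)]
  have h : ∀ g : ι → ℝ, Complex.exp (t * (s * ∑ a, g a : ℝ) * Complex.I)
      = ∏ a, Complex.exp (((t * s : ℝ) : ℂ) * g a * Complex.I) := by
    intro g
    rw [← Complex.exp_sum]
    congr 1
    push_cast
    rw [Finset.mul_sum, Finset.mul_sum, Finset.sum_mul]
    exact Finset.sum_congr rfl fun a _ => by ring
  simp only [h]
  rw [integral_fintype_prod_eq_prod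
    (fun _ (x : ℝ) => Complex.exp (((t * s : ℝ) : ℂ) * x * Complex.I))]
  simp only [← charFun_apply_real, charFun_gaussianReal, Finset.prod_const, Finset.card_univ,
    ← Complex.exp_nat_mul]
  congr 1
  push_cast
  simp
  ring

/-- Three errors remain after removing the linear statistic: the approximation error B, the term σ²
`gramDevTotal g` / (pn) of order x/√n, and the replacement of p/n by c. -/
lemma IsTypical.abs_largestEigenvalue_sub_le {μ σ c x B : ℝ} {p n : ℕ} (hp : 0 < p) (hn : 0 < n)
    (hx : 0 ≤ x) {g : Fin p × Fin n → ℝ} (hg : IsTypical x g)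
    (hB : |avgRowSum (sampleCov (dataMatrix μ σ g)) + p * σ ^ 2 / n
        - largestEigenvalue (sampleCov (dataMatrix μ σ g))| ≤ B) :
    |largestEigenvalue (sampleCov (dataMatrix μ σ g)) - (p * μ ^ 2 + (1 + c) * σ ^ 2)
      - 2 * μ * σ / n * ∑ a, g a| ≤ B + σ ^ 2 * (x / √n) + σ ^ 2 * |(p : ℝ) / n - c| := by
  have hpp : (0 : ℝ) < p := by positivity
  have hnn : (0 : ℝ) < n := by positivity
  rw [avgRowSum_sampleCov μ σ hp hn g] at hB
  rw [← total_eq_sum]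
  set l := largestEigenvalue (sampleCov (dataMatrix μ σ g))
  set r := √(n : ℝ) with hr
  have hr0 : 0 < r := Real.sqrt_pos.2 hnn
  have hrn : (n : ℝ) = r ^ 2 := (Real.sq_sqrt hnn.le).symm
  have hH : |gramDevTotal g| ≤ x * p * r := by
    refine abs_le_of_sq_le_sq (hg.gramDevTotal_sq.trans (le_of_eq ?_)) (by positivity)
    rw [hrn]; ring
  have h1 : |σ ^ 2 / (p * n) * gramDevTotal g| ≤ σ ^ 2 * (x / r) := by
    rw [abs_mul, abs_of_nonneg (by positivity : 0 ≤ σ ^ 2 / (p * n))]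
    calc σ ^ 2 / (p * n) * |gramDevTotal g| ≤ σ ^ 2 / (p * n) * (x * p * r) := by gcongr
      _ = σ ^ 2 * (x / r) := by rw [hrn]; field_simp
  have h2 : |σ ^ 2 * ((p : ℝ) / n - c)| = σ ^ 2 * |(p : ℝ) / n - c| := by
    rw [abs_mul, abs_of_nonneg (sq_nonneg σ)]
  have e : l - (p * μ ^ 2 + (1 + c) * σ ^ 2) - 2 * μ * σ / n * total g
      = -(p * μ ^ 2 + 2 * μ * σ * total g / n + σ ^ 2 + σ ^ 2 * gramDevTotal g / (p * n)
        + p * σ ^ 2 / n - l) + σ ^ 2 / (p * n) * gramDevTotal g + σ ^ 2 * ((p : ℝ) / n - c) := by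
    ring
  rw [e]
  refine (abs_add_three _ _ _).trans ?_
  rw [abs_neg, h2]
  linarith

lemma tendsto_natCast_atTop_of_div {p : ℕ → ℕ} {c : ℝ} (hc : 0 < c)
    (hp : Tendsto (fun n : ℕ => (p n : ℝ) / (n : ℝ)) atTop (𝓝 c)) :
    Tendsto (fun n => (p n : ℝ)) atTop atTop := by
  have h := hp.pos_mul_atTop hc (tendsto_natCast_atTop_atTop (R := ℝ))
  refine h.congr' ?_
  filter_upwards [eventually_gt_atTop 0] with n hn
  have : (n : ℝ) ≠ 0 := by positivity
  field_simp

/-- The centred largest eigenvalue differs from a linear statistic by a quantity tending to zero in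
probability. -/
lemma tendsto_measureReal_largestEigenvalue_sub {μ σ c : ℝ} (hμ : 0 < μ) (hσ : 0 < σ)
    (hc : 0 < c) {p : ℕ → ℕ} (hp : Tendsto (fun n : ℕ => (p n : ℝ) / (n : ℝ)) atTop (𝓝 c))
    {δ : ℝ} (hδ : 0 < δ) :
    Tendsto (fun n => (gaussianPi (Fin (p n) × Fin n)).real {g | δ <
      |largestEigenvalue (sampleCov (dataMatrix μ σ g)) - (p n * μ ^ 2 + (1 + c) * σ ^ 2)
        - 2 * μ * σ / n * ∑ a, g a|}) atTop (𝓝 0) := by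
  obtain ⟨C, ε, hC, hε, h⟩ := exists_approx_const hμ hσ hc
  have hK := two_le_formConst
  have hpt := tendsto_natCast_atTop_of_div hc hp
  rw [Metric.tendsto_nhds]
  intro η hη
  -- The level x is fixed first, making the failure probability small uniformly in n; the errors
  -- then vanish as n grows.
  obtain ⟨x, hx1, hxη⟩ : ∃ x : ℝ, 1 ≤ x ∧ 5 * formConst / x ^ 2 < η := by
    have h1 : Tendsto (fun x : ℝ => 5 * formConst / x ^ 2) atTop (𝓝 0) :=
      tendsto_const_nhds.div_atTop (tendsto_pow_atTop two_ne_zero)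
    obtain ⟨x, hx, hx'⟩ := ((eventually_ge_atTop 1).and (h1.eventually_lt_const hη)).exists
    exact ⟨x, hx, hx'⟩
  have hsn : Tendsto (fun n : ℕ => √(n : ℝ)) atTop atTop :=
    Real.tendsto_sqrt_atTop.comp tendsto_natCast_atTop_atTop
  have t1 : Tendsto (fun n : ℕ => C * √(p n : ℝ) * x / n) atTop (𝓝 0) := by
    have a1 : Tendsto (fun n : ℕ => C * x * √((p n : ℝ) / n) / √(n : ℝ)) atTop (𝓝 0) :=
      ((hp.sqrt).const_mul (C * x)).div_atTop hsn
    refine a1.congr fun n => ?_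
    rw [Real.sqrt_div (Nat.cast_nonneg _), mul_div_assoc, div_div,
      Real.mul_self_sqrt (Nat.cast_nonneg _)]
    ring
  have t2 : Tendsto (fun n : ℕ => σ ^ 2 * (x / √(n : ℝ))) atTop (𝓝 0) := by
    simpa using ((tendsto_const_nhds (x := x)).div_atTop hsn).const_mul (σ ^ 2)
  have t3 : Tendsto (fun n : ℕ => σ ^ 2 * |(p n : ℝ) / n - c|) atTop (𝓝 0) := by
    simpa using ((hp.sub_const c).abs).const_mul (σ ^ 2)
  have t4 := (t1.add t2).add t3
  simp only [add_zero] at t4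
  have hsp : Tendsto (fun n : ℕ => ε * √(p n : ℝ)) atTop atTop :=
    (Real.tendsto_sqrt_atTop.comp hpt).const_mul_atTop hε
  filter_upwards [t4.eventually_lt_const hδ, hsp.eventually_ge_atTop x,
    hpt.eventually_gt_atTop 0, eventually_gt_atTop 0,
    hp.eventually_le_const (by linarith : c < 2 * c)] with n h1 h2 h3 h4 h5
  have hpn : 0 < p n := by exact_mod_cast h3
  rw [Real.dist_eq, sub_zero, abs_of_nonneg measureReal_nonneg]
  refine lt_of_le_of_lt (le_trans (measureReal_mono (Set.ofPred_subset_ofPred.2 fun g hg hty => ?_))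
    (measureReal_not_isTypical_le hpn h4 (by linarith : 0 < x))) hxη
  have := hty.abs_largestEigenvalue_sub_le (c := c) hpn h4 (by linarith)
    (h (p n) n hpn h4 h5 x hx1 h2 g hty)
  linarith

lemma measurable_largestEigenvalue_dataMatrix (μ σ : ℝ) {p n : ℕ} :
    Measurable (fun g : Fin p × Fin n → ℝ => largestEigenvalue (sampleCov (dataMatrix μ σ g))) := by
  have h : Measurable fun (g : Fin p × Fin n → ℝ) ij => μ + σ * g ij := by fun_prop
  have e : (fun g : Fin p × Fin n → ℝ => largestEigenvalue (sampleCov (dataMatrix μ σ g)))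
      = (fun f : Fin p × Fin n → ℝ =>
          largestEigenvalue (sampleCov (Matrix.of fun i j => f (i, j))))
        ∘ fun g ij => μ + σ * g ij := by
    funext g
    simp only [Function.comp_apply, dataMatrix]
  rw [e]
  exact measurable_largestEigenvalue_sampleCov.comp h

/-- Convergence of the characteristic functions of the centred largest eigenvalue. -/
lemma tendsto_charFun_largestEigenvalue {μ σ c : ℝ} (hμ : 0 < μ) (hσ : 0 < σ)
    (hc : 0 < c) {p : ℕ → ℕ} (hp : Tendsto (fun n : ℕ => (p n : ℝ) / (n : ℝ)) atTop (𝓝 c))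
    (t : ℝ) :
    Tendsto (fun n => charFun ((gaussianPi (Fin (p n) × Fin n)).map fun g =>
      largestEigenvalue (sampleCov (dataMatrix μ σ g)) - (p n * μ ^ 2 + (1 + c) * σ ^ 2)) t)
      atTop (𝓝 (charFun (gaussianReal 0 (4 * c * μ ^ 2 * σ ^ 2).toNNReal) t)) := by
  have hlim : Tendsto (fun n : ℕ => charFun ((gaussianPi (Fin (p n) × Fin n)).map fun g =>
      2 * μ * σ / n * ∑ a, g a) t) atTop
      (𝓝 (charFun (gaussianReal 0 (4 * c * μ ^ 2 * σ ^ 2).toNNReal) t)) := by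
    simp only [charFun_map_const_mul_sum_gaussianPi, charFun_gaussianReal]
    have e : ((t : ℂ) * (0 : ℝ) * Complex.I
        - (((4 * c * μ ^ 2 * σ ^ 2).toNNReal : ℝ) : ℂ) * (t : ℂ) ^ 2 / 2)
        = ((-(4 * c * μ ^ 2 * σ ^ 2 * t ^ 2 / 2) : ℝ) : ℂ) := by
      rw [Real.coe_toNNReal _ (by positivity)]
      push_cast
      ring
    rw [e]
    have h1 : Tendsto (fun n : ℕ => -(4 * ((p n : ℝ) / n) * μ ^ 2 * σ ^ 2 * t ^ 2 / 2)) atTop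
        (𝓝 (-(4 * c * μ ^ 2 * σ ^ 2 * t ^ 2 / 2))) :=
      (((((hp.const_mul 4).mul_const _).mul_const _).mul_const _).div_const _).neg
    have h2 := (Complex.continuous_exp.tendsto _).comp
      ((Complex.continuous_ofReal.tendsto _).comp h1)
    refine h2.congr' ?_
    filter_upwards [eventually_gt_atTop 0] with n hn
    have : (n : ℝ) ≠ 0 := by positivity
    simp only [Function.comp_apply, Fintype.card_prod, Fintype.card_fin, ← Complex.ofReal_neg]
    congr 2
    push_cast
    field_simp
    ring
  rw [Metric.tendsto_nhds] at hlim ⊢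
  intro η hη
  obtain ⟨δ, hδ, hδη⟩ : ∃ δ : ℝ, 0 < δ ∧ |t| * δ ≤ η / 4 := by
    -- Adding 1 covers t = 0.
    refine ⟨η / 4 / (|t| + 1), by positivity, ?_⟩
    rw [mul_div_assoc', div_le_iff₀ (by positivity)]
    nlinarith [abs_nonneg t]
  have ht := tendsto_measureReal_largestEigenvalue_sub hμ hσ hc hp hδ
  filter_upwards [hlim (η / 2) (by positivity),
    ht.eventually_lt_const (by positivity : 0 < η / 8)] with n h1 h2
  have h3 := norm_charFun_map_sub_le (ν := gaussianPi (Fin (p n) × Fin n))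
    (F := fun g => largestEigenvalue (sampleCov (dataMatrix μ σ g))
      - (p n * μ ^ 2 + (1 + c) * σ ^ 2)) (A := fun g => 2 * μ * σ / n * ∑ a, g a)
    ((measurable_largestEigenvalue_dataMatrix μ σ).sub_const _) (by fun_prop) t hδ.le
  rw [← dist_eq_norm] at h3
  refine lt_of_le_of_lt (dist_triangle _ _ _) (lt_of_le_of_lt (add_le_add_left h3 _) ?_)
  linarith

/-! ### Transfer to arbitrary probability spaces -/

/-- The standardized entries of a Gaussian matrix have the standard Gaussian law. -/
lemma hasLaw_standardized {μ σ : ℝ} (hσ : 0 < σ) {p n : ℕ} {Ω : Type*} {mΩ : MeasurableSpace Ω}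
    {P : Measure Ω} {X : Ω → Matrix (Fin p) (Fin n) ℝ}
    (hX : ∀ i j, HasLaw (fun ω => X ω i j)
      (gaussianReal μ (⟨σ ^ 2, sq_nonneg σ⟩ : NNReal)) P)
    (hind : iIndepFun (fun (ij : Fin p × Fin n) (ω : Ω) => X ω ij.1 ij.2) P) :
    HasLaw (fun ω (ij : Fin p × Fin n) => (X ω ij.1 ij.2 - μ) / σ)
      (gaussianPi (Fin p × Fin n)) P := by
  refine iIndepFun.hasLaw_pi (fun ij => ?_)
    (hind.comp (fun _ x => (x - μ) / σ) (fun _ => by fun_prop))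
  have h := gaussianReal_div_const (gaussianReal_sub_const (hX ij.1 ij.2) μ) σ
  convert h using 2
  · simp
  · exact (div_self (a := NNReal.mk (σ ^ 2) (sq_nonneg σ))
      (fun h => pow_ne_zero 2 hσ.ne' (congrArg NNReal.toReal h))).symm

lemma dataMatrix_standardized {μ σ : ℝ} (hσ : 0 < σ) {p n : ℕ} (X : Matrix (Fin p) (Fin n) ℝ) :
    dataMatrix μ σ (fun ij => (X ij.1 ij.2 - μ) / σ) = X := by
  ext i j
  simp only [dataMatrix, Matrix.of_apply]
  field_simp
  ring

theorem theorem1p1 (μ σ c : ℝ) (hμ : 0 < μ) (hσ : 0 < σ) (hc : 0 < c) :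
    ∃ C₁ C₂ C₃ : ℝ, 0 < C₁ ∧ 0 < C₂ ∧ 0 < C₃ ∧
      ∀ (p : ℕ → ℕ), Tendsto (fun n : ℕ => (p n : ℝ) / (n : ℝ)) atTop (𝓝 c) →
      ∀ (Ω : ℕ → Type*) [∀ n, MeasurableSpace (Ω n)]
        (P : ∀ n, Measure (Ω n)) [∀ n, IsProbabilityMeasure (P n)]
        (X : ∀ n, Ω n → Matrix (Fin (p n)) (Fin n) ℝ),
      (∀ n i j, HasLaw (fun ω => X n ω i j)
        (gaussianReal μ (⟨σ ^ 2, sq_nonneg σ⟩ : NNReal)) (P n)) →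
      (∀ n, iIndepFun (fun (ij : Fin (p n) × Fin n) (ω : Ω n) => X n ω ij.1 ij.2) (P n)) →
      TendstoInDistribution
        (fun n ω => largestEigenvalue (sampleCov (X n ω))
          - ((p n : ℝ) * μ ^ 2 + (1 + c) * σ ^ 2))
        atTop (id : ℝ → ℝ) P
        (gaussianReal 0 (4 * c * μ ^ 2 * σ ^ 2).toNNReal) ∧
      ∀ᶠ n in atTop, ∀ x : ℝ, 0 < x →
        (P n).real {ω | C₁ * √(p n : ℝ) * x / (n : ℝ) <
            |avgRowSum (sampleCov (X n ω)) + (p n : ℝ) * σ ^ 2 / (n : ℝ)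
              - largestEigenvalue (sampleCov (X n ω))|}
          < C₂ / x ^ 2 + C₃ / (p n : ℝ) := by
  obtain ⟨C₁, C₂, C₃, h₁, h₂, h₃, htail⟩ := exists_tail_bound hμ hσ hc
  refine ⟨C₁, C₂, C₃, h₁, h₂, h₃, fun p hp Ω _ P _ X hX hind => ?_⟩
  have hG := fun n => hasLaw_standardized hσ (hX n) (hind n)
  have hXG : ∀ n ω, X n ω = dataMatrix μ σ (fun ij => (X n ω ij.1 ij.2 - μ) / σ) :=
    fun n ω => (dataMatrix_standardized hσ (X n ω)).symm
  set F : ∀ n, (Fin (p n) × Fin n → ℝ) → ℝ := fun n g =>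
    largestEigenvalue (sampleCov (dataMatrix μ σ g)) - (p n * μ ^ 2 + (1 + c) * σ ^ 2) with hF
  have hFm : ∀ n, Measurable (F n) := fun n =>
    (measurable_largestEigenvalue_dataMatrix μ σ).sub_const _
  have hFX : ∀ n, (fun ω => largestEigenvalue (sampleCov (X n ω))
      - ((p n : ℝ) * μ ^ 2 + (1 + c) * σ ^ 2))
      = F n ∘ fun ω ij => (X n ω ij.1 ij.2 - μ) / σ := by
    intro n
    funext ω
    simp only [hF, Function.comp_apply, ← hXG]
  refine ⟨⟨fun n => ?_, aemeasurable_id, ?_⟩, ?_⟩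
  · rw [hFX]
    exact (hFm n).comp_aemeasurable (hG n).aemeasurable
  · refine ProbabilityMeasure.tendsto_of_tendsto_charFun fun t => ?_
    have h := tendsto_charFun_largestEigenvalue hμ hσ hc hp t
    simp only [ProbabilityMeasure.coe_mk, Measure.map_id]
    refine h.congr fun n => ?_
    rw [hFX, ← AEMeasurable.map_map_of_aemeasurable (hFm n).aemeasurable (hG n).aemeasurable,
      (hG n).map_eq]
  · filter_upwards [(tendsto_natCast_atTop_of_div hc hp).eventually_gt_atTop 0,
      eventually_gt_atTop 0, hp.eventually_le_const (by linarith : c < 2 * c)] with n hpn hn hpn2 x hx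
    refine lt_of_le_of_lt ?_ (htail (p n) n (by exact_mod_cast hpn) hn hpn2 x hx)
    -- Only an upper bound is required, and this direction of the image-measure formula holds
    -- without measurability of the event.
    have h := Measure.le_map_apply (hG n).aemeasurable {g | C₁ * √(p n : ℝ) * x / n <
        |avgRowSum (sampleCov (dataMatrix μ σ g)) + p n * σ ^ 2 / n
          - largestEigenvalue (sampleCov (dataMatrix μ σ g))|}
    rw [(hG n).map_eq] at h
    refine le_trans (le_of_eq ?_) (ENNReal.toReal_mono (measure_ne_top _ _) h)
    simp only [Measure.real, Set.preimage_ofPred_eq, ← hXG]
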